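/- Fix smooth radial functions $\varphi,\chi:\mathbb R^3\to[0,1]$, with $\varphi$ supported in $\{\tfrac34\le|\xi|\le\tfrac83\}$ and $\chi$ supported in $\{|\xi|\le\tfrac43\}$, such that $\chi(\xi)+\sum_{q\ge0}\varphi(2^{-q}\xi)=1$ for all $\xi\in\mathbb R^3$ and $\sum_{q\in\mathbb Z}\varphi(2^{-q}\xi)=1$ for all $\xi\neq0$. For a tempered distribution $f$ on $\mathbb R^3$ and $j\in\mathbb Z$ let $\dot\Delta_jf=\varphi(2^{-j}D)f$ and $\dot S_jf=\chi(2^{-j}D)f$ be the Fourier multipliers with symbols $\varphi(2^{-j}\xi)$ and $\chi(2^{-j}\xi)$. Let $\mathcal S'_h$ be the set of tempered distributions $f$ with $\dot S_jf\to0$ in $\mathcal S'$ as $j\to-\infty$ (equivalently $f=\sum_{j\in\mathbb Z}\dot\Delta_jf$ in $\mathcal S'$), and let $\dot B^\sigma_{p,r}$ be the set of $f\in\mathcal S'_h$ for which $\|f\|_{\dot B^\sigma_{p,r}}=\big\|\big(2^{j\sigma}\|\dot\Delta_jf\|_{L^p}\big)_{j\in\mathbb Z}\big\|_{\ell^r}$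 is finite. The product $uv$ of two tempered distributions is the limit in $\mathcal S'$ of $\dot S_nu\,\dot S_nv$ as $n\to\infty$, if this limit exists, and $[\dot\Delta_j,b]a=\dot\Delta_j(ba)-b\,\dot\Delta_ja$. Let $s>0$ and $\rho\in(2,\infty)$. Then there is a constant $C$, depending only on $s$, $\rho$, $\varphi$ and $\chi$, such that for all $a\in\dot B^{s-\frac2\rho}_{2,1}\cap\dot B^{\frac2\rho-1}_{\infty,\infty}$ and $b\in\dot B^{s+1-\frac2\rho}_{2,1}\cap\dot B^{\frac2\rho}_{\infty,\infty}$ the products $ba$ and $b\,\dot\Delta_ja$ ($j\in\mathbb Z$) exist, and $$\sum_{j\in\mathbb Z}2^{js}\big\|[\dot\Delta_j,b]a\big\|_{L^2}\le C\Big(\|a\|_{\dot B^{s-\frac2\rho}_{2,1}}\|b\|_{\dot B^{\frac2\rho}_{\infty,\infty}}+\|b\|_{\dot B^{s+1-\frac2\rho}_{2,1}}\|a\|_{\dot B^{\frac2\rho-1}_{\infty,\infty}}\Big).$$ -/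

import Mathlib

open MeasureTheory Filter
open scoped SchwartzMap ENNReal NNReal Topology ContDiff

noncomputable section

namespace LittlewoodPaley

/-- The Euclidean space `ℝ³`. -/
abbrev R3 : Type := EuclideanSpace ℝ (Fin 3)

/-- Complex-valued tempered distributions on `ℝ³`. -/
abbrev Distr : Type := 𝓢'(R3, ℂ)

/-- A homogeneous Littlewood--Paley pair `(φ, χ)` on `ℝ³`: two smooth radial functions with values
in `[0, 1]`, `φ` supported in the annulus `3/4 ≤ |ξ| ≤ 8/3` and `χ` supported in the ball
`|ξ| ≤ 4/3`, with `χ(ξ) + ∑_{q ≥ 0} φ(2^{-q} ξ) = 1` for all `ξ` and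
`∑_{q ∈ ℤ} φ(2^{-q} ξ) = 1` for all `ξ ≠ 0`. -/
structure DyadicPair where
  φ : R3 → ℝ
  χ : R3 → ℝ
  φ_smooth : ContDiff ℝ ∞ φ
  χ_smooth : ContDiff ℝ ∞ χ
  φ_radial : ∀ ξ η : R3, ‖ξ‖ = ‖η‖ → φ ξ = φ η
  χ_radial : ∀ ξ η : R3, ‖ξ‖ = ‖η‖ → χ ξ = χ η
  φ_mem : ∀ ξ, φ ξ ∈ Set.Icc (0 : ℝ) 1
  χ_mem : ∀ ξ, χ ξ ∈ Set.Icc (0 : ℝ) 1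
  φ_supp : Function.support φ ⊆ {ξ | 3 / 4 ≤ ‖ξ‖ ∧ ‖ξ‖ ≤ 8 / 3}
  χ_supp : Function.support χ ⊆ {ξ | ‖ξ‖ ≤ 4 / 3}
  sum_nat : ∀ ξ : R3, HasSum (fun q : ℕ => φ ((2 : ℝ) ^ (-(q : ℤ)) • ξ)) (1 - χ ξ)
  sum_int : ∀ ξ : R3, ξ ≠ 0 → HasSum (fun q : ℤ => φ ((2 : ℝ) ^ (-q) • ξ)) 1

/-- The `L^p` norm of a tempered distribution: the norm of the `L^p` function which represents it,
and `∞` if there is none. -/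
def lpNorm (p : ℝ≥0∞) [Fact (1 ≤ p)] (f : Distr) : ℝ≥0∞ :=
  ⨅ (g : Lp ℂ p (volume : Measure R3)) (_ : Lp.toTemperedDistribution g = f), ‖g‖ₑ

/-- The function `g`, smooth and with all its derivatives of at most polynomial growth, represents
the tempered distribution `f`, that is, `f ψ = ∫ ψ g` for all Schwartz functions `ψ`. -/
def Represents (g : R3 → ℂ) (f : Distr) : Prop :=
  ∃ hg : g.HasTemperateGrowth, hg.toTemperedDistribution volume = f

namespace DyadicPair

variable (D : DyadicPair)

/-- The dyadic block `Δ_j f = φ(2^{-j} D) f`, the Fourier multiplier with symbol `φ(2^{-j} ξ)`. -/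
def block (j : ℤ) (f : Distr) : Distr :=
  TemperedDistribution.fourierMultiplierCLM ℂ (fun ξ : R3 => ((D.φ ((2 : ℝ) ^ (-j) • ξ) : ℝ) : ℂ)) f

/-- The low-frequency cut-off `S_j f = χ(2^{-j} D) f`. -/
def lowFreq (j : ℤ) (f : Distr) : Distr :=
  TemperedDistribution.fourierMultiplierCLM ℂ (fun ξ : R3 => ((D.χ ((2 : ℝ) ^ (-j) • ξ) : ℝ) : ℂ)) f

/-- `f ∈ S'_h`: `S_j f → 0` in `S'` as `j → -∞`, which says that `f = ∑_{j ∈ ℤ} Δ_j f` in `S'`. -/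
def MemSh (f : Distr) : Prop :=
  Tendsto (fun j : ℤ => D.lowFreq j f) atBot (𝓝 0)

/-- The homogeneous Besov norm of `Ḃ^s_{p,r}`, with values in `[0, ∞]`. -/
def besovNorm (s : ℝ) (p r : ℝ≥0∞) [Fact (1 ≤ p)] (f : Distr) : ℝ≥0∞ :=
  if r = ⊤ then ⨆ j : ℤ, (2 : ℝ≥0∞) ^ ((j : ℝ) * s) * lpNorm p (D.block j f)
  else (∑' j : ℤ, ((2 : ℝ≥0∞) ^ ((j : ℝ) * s) * lpNorm p (D.block j f)) ^ r.toReal) ^ (1 / r.toReal)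

/-- Membership in the homogeneous Besov space `Ḃ^s_{p,r}`. -/
def MemBesov (s : ℝ) (p r : ℝ≥0∞) [Fact (1 ≤ p)] (f : Distr) : Prop :=
  D.MemSh f ∧ D.besovNorm s p r f < ⊤

/-- The tempered distribution `P` is the product `u v`: it is the limit in `S'` of the products
`S_n u · S_n v = ∑_{j, j' < n} Δ_j u Δ_{j'} v` of smooth functions as `n → ∞`. The functions `g n`
are the smooth functions `S_n u`, so `P` is determined by `u` and `v`. -/
def HasProduct (u v P : Distr) : Prop :=
  ∃ g : ℕ → R3 → ℂ, (∀ n, Represents (g n) (D.lowFreq n u)) ∧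
    Tendsto (fun n : ℕ => TemperedDistribution.smulLeftCLM ℂ (g n) (D.lowFreq n v)) atTop (𝓝 P)

/-- The tempered distribution `c` is the commutator `[Δ_j, b] a = Δ_j (b a) - b Δ_j a`; in
particular both products exist. -/
def IsCommutator (j : ℤ) (b a c : Distr) : Prop :=
  ∃ P Q : Distr, D.HasProduct b a P ∧ D.HasProduct b (D.block j a) Q ∧ c = D.block j P - Q

end DyadicPair

end LittlewoodPaley

end

/-!
The commutator `[Δ_j, b] a` is the limit, in the sense of tempered distributions, of finite sums of
the pieces `[Δ_j, Δ_l b] Δ_k a` (`DyadicPair.lpNorm_two_commutator_tsum_le`), so it is enough to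
bound every piece in `L²` and to sum. No paraproduct has to be named; all cancellations of the Bony
decomposition are visible on the single pieces.

* If `|k - j| ≤ 2`, the piece is a true commutator. The kernel of `Δ_j` has first moment of order
  `2^{-j}` and the Lipschitz constant of `Δ_l b` is of order `2^l ‖Δ_l b‖_∞`, so that
  `‖[Δ_j, Δ_l b] Δ_k a‖_{L²} ≤ C min(1, 2^{l-j}) ‖Δ_l b‖_∞ ‖Δ_k a‖_{L²}`. The sum over `l`
  converges because the regularity index `2/ρ` of `b` lies in `(0, 1)`.
* If `|k - j| ≥ 3`, then `Δ_j Δ_k a = 0` and the piece is `Δ_j (Δ_l b Δ_k a)`. The spectrum of the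
  product meets the annulus of `Δ_j` only if `j ≤ l + 2` and `k ≤ l + 2`, and there the bound
  `‖Δ_l b‖_{L²} ‖Δ_k a‖_∞` is summable: the sum over `j` converges because `s > 0`, the one over `k`
  because `1 - 2/ρ > 0`.

The product `b a` exists because `S_n b S_n a` differs from
`S_0 a S_n b + S_0 b (S_n a - S_0 a)`, which converges as the multiplication by a fixed smooth
function is continuous, by the sum of `Δ_l b Δ_k a` over `0 ≤ l, k < n`. The blocks with `k ≤ l + 2`
are summable in `L²`; the others have their spectrum in an annulus of size `2^k` and are summable in
`H^{-2}` (`DyadicPair.exists_tendsto_mul`).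

Underneath lies the fact that `m(D) f`, for a Schwartz symbol `m` and a tempered distribution `f`,
is the smooth function `x ↦ f (τ_x 𝓕 m)` of at most polynomial growth (`smoothRep`). It rests on a
Fubini theorem for tempered distributions, `apply_eq_integral_of_forall_iteratedFDeriv`.
-/

open MeasureTheory Filter
open scoped SchwartzMap ENNReal NNReal Topology ContDiff

noncomputable section

namespace LittlewoodPaley

/-! ### Translates of Schwartz functions -/

section Translation

open LineDeriv SchwartzMap

variable {E : Type*} [NormedAddCommGroup E] [NormedSpace ℝ E]

theorem lineDerivOp_comm (x y : E) (u : 𝓢(E, ℂ)) : ∂_{x} (∂_{y} u) = ∂_{y} (∂_{x} u) := by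
  have h : ∀ (a b : E) (z : E), ∂_{a} (∂_{b} u) z = fderiv ℝ (fderiv ℝ u) z a b := by
    intro a b z
    rw [lineDerivOp_apply_eq_fderiv]
    have h1 : (⇑(∂_{b} u : 𝓢(E, ℂ))) = fun w => fderiv ℝ u w b := by
      ext w; exact lineDerivOp_apply_eq_fderiv b u w
    rw [h1]
    have h2 : DifferentiableAt ℝ (fderiv ℝ u) z :=
      (((u.smooth 2).fderiv_right (m := 1) (by norm_num)).differentiable
        one_ne_zero).differentiableAt
    rw [fderiv_clm_apply h2 (differentiableAt_const b)]
    simp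
  ext z
  rw [h, h]
  exact ((u.smooth 2).contDiffAt.isSymmSndFDerivAt (by simp)).eq x y

theorem lineDerivOp_iteratedLineDerivOp_comm {n : ℕ} (v : Fin n → E) (y : E) (u : 𝓢(E, ℂ)) :
    ∂_{y} (∂^{v} u) = ∂^{v} (∂_{y} u) := by
  induction n with
  | zero => simp
  | succ n ih =>
    rw [iteratedLineDerivOp_succ_left, iteratedLineDerivOp_succ_left, lineDerivOp_comm, ih]

/-- Stated for the evaluation of the iterated derivative at fixed vectors, so that mean value
estimates only concern scalar functions of one variable. -/
theorem hasDerivAt_iteratedFDeriv_line (n : ℕ) (u : 𝓢(E, ℂ)) (z y : E) (v : Fin n → E) (t : ℝ) :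
    HasDerivAt (fun t : ℝ => iteratedFDeriv ℝ n u (z - t • y) v)
      (-iteratedFDeriv ℝ n (∂_{y} u : 𝓢(E, ℂ)) (z - t • y) v) t := by
  simp_rw [← iteratedLineDerivOp_eq_iteratedFDeriv]
  rw [← lineDerivOp_iteratedLineDerivOp_comm, lineDerivOp_apply_eq_fderiv]
  have h1 : HasDerivAt (fun t : ℝ => z - t • y) (-y) t := by
    simpa using ((hasDerivAt_id t).smul_const y).const_sub z
  have h2 := ((∂^{v} u : 𝓢(E, ℂ)).hasFDerivAt (z - t • y)).comp_hasDerivAt t h1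
  simpa [Function.comp_def] using h2

theorem seminorm_lineDerivOp_le (m n : ℕ) (u : 𝓢(E, ℂ)) (y : E) :
    SchwartzMap.seminorm ℝ m n (∂_{y} u : 𝓢(E, ℂ)) ≤ SchwartzMap.seminorm ℝ m (n + 1) u * ‖y‖ := by
  apply seminorm_le_bound _ _ _ _ (by positivity)
  intro x
  have h : ‖iteratedFDeriv ℝ n (∂_{y} u : 𝓢(E, ℂ)) x‖ ≤ ‖iteratedFDeriv ℝ (n + 1) u x‖ * ‖y‖ := by
    apply ContinuousMultilinearMap.opNorm_le_bound (by positivity)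
    intro v
    rw [← iteratedLineDerivOp_eq_iteratedFDeriv, ← lineDerivOp_iteratedLineDerivOp_comm]
    have h2 := (iteratedFDeriv ℝ (n + 1) u x).le_opNorm (Fin.cons y v : Fin (n + 1) → E)
    rw [← iteratedLineDerivOp_eq_iteratedFDeriv, iteratedLineDerivOp_succ_left,
      Fin.prod_univ_succ] at h2
    simpa [mul_assoc, Fin.tail_def] using h2
  calc _ ≤ ‖x‖ ^ m * (‖iteratedFDeriv ℝ (n + 1) u x‖ * ‖y‖) := by gcongr
    _ = (‖x‖ ^ m * ‖iteratedFDeriv ℝ (n + 1) u x‖) * ‖y‖ := by ring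
    _ ≤ _ := by gcongr; exact le_seminorm ℝ m (n + 1) u x

theorem iteratedFDeriv_compSubConstCLM (n : ℕ) (u : 𝓢(E, ℂ)) (x z : E) :
    iteratedFDeriv ℝ n (compSubConstCLM ℂ x u) z = iteratedFDeriv ℝ n u (z - x) := by
  have : (⇑(compSubConstCLM ℂ x u)) = fun z => u (z - x) := by ext; simp
  rw [this, iteratedFDeriv_comp_sub]

theorem pow_mul_iteratedFDeriv_sub_le (m n : ℕ) (u : 𝓢(E, ℂ)) (x z : E) :
    ‖z‖ ^ m * ‖iteratedFDeriv ℝ n u (z - x)‖ ≤ (1 + ‖x‖) ^ m *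
      (2 ^ m * (Finset.Iic (m, n)).sup (fun p => SchwartzMap.seminorm ℝ p.1 p.2) u) := by
  have h := one_add_le_sup_seminorm_apply (𝕜 := ℝ) (m := (m, n)) le_rfl le_rfl u (z - x)
  refine le_trans ?_ (mul_le_mul_of_nonneg_left h (by positivity))
  rw [← mul_assoc, ← mul_pow]
  gcongr
  have : ‖z‖ ≤ ‖z - x‖ + ‖x‖ := by simpa using norm_add_le (z - x) x
  nlinarith [norm_nonneg x, norm_nonneg (z - x)]

/-- Schwartz seminorms grow polynomially under translation. -/
theorem seminorm_compSubConstCLM_le (m n : ℕ) (u : 𝓢(E, ℂ)) (x : E) :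
    SchwartzMap.seminorm ℝ m n (compSubConstCLM ℂ x u) ≤ (1 + ‖x‖) ^ m *
      (2 ^ m * (Finset.Iic (m, n)).sup (fun p => SchwartzMap.seminorm ℝ p.1 p.2) u) := by
  apply seminorm_le_bound _ _ _ _ (by positivity)
  intro z
  rw [iteratedFDeriv_compSubConstCLM]
  exact pow_mul_iteratedFDeriv_sub_le m n u x z

/-- First-order estimate for a translation by `y`. The right-hand side is of size `|y|`, as
`∂_y` is linear in `y`. -/
theorem seminorm_compSubConstCLM_sub_le (m n : ℕ) (u : 𝓢(E, ℂ)) (y : E) :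
    SchwartzMap.seminorm ℝ m n (compSubConstCLM ℂ y u - u) ≤ (1 + ‖y‖) ^ m * (2 ^ m *
      (Finset.Iic (m, n)).sup (fun p => SchwartzMap.seminorm ℝ p.1 p.2) (∂_{y} u)) := by
  apply seminorm_le_bound _ _ _ _ (by positivity)
  intro z
  set C := (2 ^ m * (Finset.Iic (m, n)).sup (fun p => SchwartzMap.seminorm ℝ p.1 p.2) (∂_{y} u))
  have hC : 0 ≤ (1 + ‖y‖) ^ m * C := by positivity
  rcases eq_or_ne (‖z‖ ^ m) 0 with h0 | h0
  · rw [h0, zero_mul]; exact hC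
  have hpos : 0 < ‖z‖ ^ m := lt_of_le_of_ne (by positivity) h0.symm
  rw [← le_div_iff₀' hpos]
  apply ContinuousMultilinearMap.opNorm_le_bound (by positivity)
  intro v
  have hsub : iteratedFDeriv ℝ n (⇑(compSubConstCLM ℂ y u - u)) z v
      = iteratedFDeriv ℝ n u (z - (1 : ℝ) • y) v - iteratedFDeriv ℝ n u (z - (0 : ℝ) • y) v := by
    have : (⇑(compSubConstCLM ℂ y u - u)) = (⇑(compSubConstCLM ℂ y u)) - ⇑u := by ext; simp
    rw [this, iteratedFDeriv_sub_apply ((compSubConstCLM ℂ y u).smooth n).contDiffAt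
      (u.smooth n).contDiffAt, iteratedFDeriv_compSubConstCLM]
    simp
  rw [hsub]
  have key := norm_image_sub_le_of_norm_deriv_le_segment_01'
    (f := fun t : ℝ => iteratedFDeriv ℝ n u (z - t • y) v)
    (C := (1 + ‖y‖) ^ m * C / ‖z‖ ^ m * ∏ i, ‖v i‖)
    (fun t _ => (hasDerivAt_iteratedFDeriv_line n u z y v t).hasDerivWithinAt) ?_
  · exact key
  · intro t ht
    rw [norm_neg]
    refine (ContinuousMultilinearMap.le_opNorm _ _).trans ?_
    gcongr
    rw [le_div_iff₀' hpos]
    refine (pow_mul_iteratedFDeriv_sub_le m n (∂_{y} u) (t • y) z).trans ?_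
    gcongr
    rw [norm_smul, Real.norm_of_nonneg ht.1]
    nlinarith [norm_nonneg y, ht.2, ht.1]

theorem finsetSup_seminorm_lineDerivOp_le (s : Finset (ℕ × ℕ)) (u : 𝓢(E, ℂ)) (y : E) :
    s.sup (fun p => SchwartzMap.seminorm ℝ p.1 p.2) (∂_{y} u : 𝓢(E, ℂ)) ≤
      s.sup (fun p => SchwartzMap.seminorm ℝ (E := E) (F := ℂ) p.1 (p.2 + 1)) u * ‖y‖ := by
  apply Seminorm.finset_sup_apply_le (by positivity)
  intro p hp
  refine (seminorm_lineDerivOp_le p.1 p.2 u y).trans ?_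
  gcongr
  exact Seminorm.le_finset_sup_apply (p := fun p : ℕ × ℕ =>
    SchwartzMap.seminorm ℝ (E := E) (F := ℂ) p.1 (p.2 + 1)) hp

theorem exists_seminorm_compSubConstCLM_sub_le (m n : ℕ) (u : 𝓢(E, ℂ)) :
    ∃ C : ℝ, 0 ≤ C ∧ ∀ y : E, ‖y‖ ≤ 1 →
      SchwartzMap.seminorm ℝ m n (compSubConstCLM ℂ y u - u) ≤ C * ‖y‖ := by
  refine ⟨2 ^ m * (2 ^ m * (Finset.Iic (m, n)).sup
    (fun p => SchwartzMap.seminorm ℝ (E := E) (F := ℂ) p.1 (p.2 + 1)) u), by positivity, ?_⟩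
  intro y hy
  refine (seminorm_compSubConstCLM_sub_le m n u y).trans ?_
  rw [mul_assoc, mul_assoc]
  gcongr
  · linarith
  · exact finsetSup_seminorm_lineDerivOp_le _ u y

/-- Second-order Taylor estimate for translations in every Schwartz seminorm. -/
theorem exists_seminorm_taylor_le (m n : ℕ) (u : 𝓢(E, ℂ)) :
    ∃ C : ℝ, 0 ≤ C ∧ ∀ y : E, ‖y‖ ≤ 1 →
      SchwartzMap.seminorm ℝ m n (compSubConstCLM ℂ y u - u + ∂_{y} u) ≤ C * ‖y‖ ^ 2 := by
  set S := (Finset.Iic (m, n)).sup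
    (fun p => SchwartzMap.seminorm ℝ (E := E) (F := ℂ) p.1 (p.2 + 1 + 1)) u with hS
  refine ⟨2 ^ m * (2 ^ m * S), by positivity, ?_⟩
  intro y hy
  apply seminorm_le_bound _ _ _ _ (by positivity)
  intro z
  rcases eq_or_ne (‖z‖ ^ m) 0 with h0 | h0
  · rw [h0, zero_mul]; positivity
  have hpos : 0 < ‖z‖ ^ m := lt_of_le_of_ne (by positivity) h0.symm
  rw [← le_div_iff₀' hpos]
  apply ContinuousMultilinearMap.opNorm_le_bound (by positivity)
  intro v
  set w : 𝓢(E, ℂ) := ∂_{y} u with hw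
  have hsub : iteratedFDeriv ℝ n (⇑(compSubConstCLM ℂ y u - u + w)) z v
      = (iteratedFDeriv ℝ n u (z - (1 : ℝ) • y) v + (1 : ℝ) • iteratedFDeriv ℝ n w z v)
        - (iteratedFDeriv ℝ n u (z - (0 : ℝ) • y) v + (0 : ℝ) • iteratedFDeriv ℝ n w z v) := by
    have : (⇑(compSubConstCLM ℂ y u - u + w)) = ((⇑(compSubConstCLM ℂ y u)) - ⇑u) + ⇑w := by
      ext; simp
    rw [this, iteratedFDeriv_add_apply
      (f := ⇑(compSubConstCLM ℂ y u) - ⇑u)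
      (((compSubConstCLM ℂ y u).smooth n).sub (u.smooth n)).contDiffAt (w.smooth n).contDiffAt,
      iteratedFDeriv_sub_apply ((compSubConstCLM ℂ y u).smooth n).contDiffAt
      (u.smooth n).contDiffAt, iteratedFDeriv_compSubConstCLM]
    simp only [one_smul, zero_smul, sub_zero, add_zero, _root_.add_apply,
      _root_.sub_apply]
    ring
  rw [hsub]
  refine norm_image_sub_le_of_norm_deriv_le_segment_01'
    (f := fun t : ℝ => iteratedFDeriv ℝ n u (z - t • y) v + t • iteratedFDeriv ℝ n w z v)
    (C := 2 ^ m * (2 ^ m * S) * ‖y‖ ^ 2 / ‖z‖ ^ m * ∏ i, ‖v i‖)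
    (fun t _ => ((hasDerivAt_iteratedFDeriv_line n u z y v t).add
      ((hasDerivAt_id t).smul_const _)).hasDerivWithinAt) ?_
  intro t ht
  have hty : ‖t • y‖ ≤ ‖y‖ := by
    rw [norm_smul, Real.norm_of_nonneg ht.1]
    nlinarith [norm_nonneg y, ht.2, ht.1]
  have e : -iteratedFDeriv ℝ n (⇑w) (z - t • y) v + (1 : ℝ) • iteratedFDeriv ℝ n w z v
      = -(iteratedFDeriv ℝ n (⇑(compSubConstCLM ℂ (t • y) w - w)) z v) := by
    have : (⇑(compSubConstCLM ℂ (t • y) w - w)) = (⇑(compSubConstCLM ℂ (t • y) w)) - ⇑w := by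
      ext; simp
    rw [this, iteratedFDeriv_sub_apply ((compSubConstCLM ℂ (t • y) w).smooth n).contDiffAt
      (w.smooth n).contDiffAt, iteratedFDeriv_compSubConstCLM]
    simp only [one_smul, _root_.sub_apply]
    ring
  rw [← hw, e, norm_neg]
  refine (ContinuousMultilinearMap.le_opNorm _ _).trans ?_
  gcongr
  rw [le_div_iff₀' hpos]
  refine (le_seminorm ℝ m n _ z).trans ((seminorm_compSubConstCLM_sub_le m n w (t • y)).trans ?_)
  rw [mul_assoc, mul_assoc, sq]
  have h1 := finsetSup_seminorm_lineDerivOp_le (Finset.Iic (m, n)) w (t • y)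
  have h2 : (Finset.Iic (m, n)).sup
      (fun p => SchwartzMap.seminorm ℝ (E := E) (F := ℂ) p.1 (p.2 + 1)) w ≤ S * ‖y‖ := by
    apply Seminorm.finset_sup_apply_le (by positivity)
    intro p hp
    refine (seminorm_lineDerivOp_le p.1 (p.2 + 1) u y).trans ?_
    gcongr
    exact Seminorm.le_finset_sup_apply (p := fun p : ℕ × ℕ =>
      SchwartzMap.seminorm ℝ (E := E) (F := ℂ) p.1 (p.2 + 1 + 1)) hp
  gcongr
  · linarith
  · refine h1.trans ?_
    rw [← mul_assoc]
    gcongr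

end Translation

/-! ### Tempered distributions evaluated on translates -/

section Regularization

open LineDeriv SchwartzMap FourierTransform

variable {E : Type*} [NormedAddCommGroup E] [NormedSpace ℝ E]

/-- A tempered distribution has finite order. -/
theorem exists_norm_le_finsetSup_seminorm (f : 𝓢'(E, ℂ)) :
    ∃ (s : Finset (ℕ × ℕ)) (C : ℝ), 0 ≤ C ∧
      ∀ ψ : 𝓢(E, ℂ), ‖f ψ‖ ≤ C * s.sup (fun p => SchwartzMap.seminorm ℝ p.1 p.2) ψ := by
  let q : Seminorm ℂ 𝓢(E, ℂ) := (normSeminorm ℂ ℂ).comp (f : 𝓢(E, ℂ) →L[ℂ] ℂ).toLinearMap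
  have hq : Continuous q := continuous_norm.comp (f : 𝓢(E, ℂ) →L[ℂ] ℂ).continuous
  obtain ⟨s, C, -, h⟩ := Seminorm.bound_of_continuous (schwartz_withSeminorms ℂ E ℂ) q hq
  refine ⟨s, C, C.2, fun ψ => (h ψ).trans ?_⟩
  rw [_root_.smul_apply, NNReal.smul_def, smul_eq_mul]
  refine mul_le_mul_of_nonneg_left ?_ C.2
  apply Seminorm.finset_sup_apply_le (by positivity)
  intro p hp
  exact Seminorm.le_finset_sup_apply (p := fun p : ℕ × ℕ =>
    SchwartzMap.seminorm ℝ (E := E) (F := ℂ) p.1 p.2) hp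

theorem finsetSup_le_sum (s : Finset (ℕ × ℕ)) (ψ : 𝓢(E, ℂ)) (c : ℕ × ℕ → ℝ) (r : ℝ)
    (hc : ∀ p, 0 ≤ c p) (hr : 0 ≤ r)
    (h : ∀ p ∈ s, SchwartzMap.seminorm ℝ p.1 p.2 ψ ≤ c p * r) :
    s.sup (fun p => SchwartzMap.seminorm ℝ p.1 p.2) ψ ≤ (∑ p ∈ s, c p) * r := by
  have : 0 ≤ ∑ p ∈ s, c p := Finset.sum_nonneg fun p _ => hc p
  apply Seminorm.finset_sup_apply_le (by positivity)
  intro p hp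
  refine (h p hp).trans ?_
  gcongr
  exact Finset.single_le_sum (f := c) (fun p _ => hc p) hp

theorem exists_norm_compSubConstCLM_le (f : 𝓢'(E, ℂ)) (u : 𝓢(E, ℂ)) :
    ∃ (k : ℕ) (C : ℝ), ∀ x : E, ‖f (compSubConstCLM ℂ x u)‖ ≤ C * (1 + ‖x‖) ^ k := by
  obtain ⟨s, C, hC, h⟩ := exists_norm_le_finsetSup_seminorm f
  set c : ℕ × ℕ → ℝ := fun p => 2 ^ p.1 *
    (Finset.Iic p).sup (fun p => SchwartzMap.seminorm ℝ (E := E) (F := ℂ) p.1 p.2) u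
  refine ⟨s.sup Prod.fst, C * ∑ p ∈ s, c p, fun x => (h _).trans ?_⟩
  rw [mul_assoc]
  refine mul_le_mul_of_nonneg_left ?_ hC
  apply finsetSup_le_sum _ _ _ _ (fun p => by positivity) (by positivity)
  intro p hp
  refine (seminorm_compSubConstCLM_le p.1 p.2 u x).trans ?_
  rw [mul_comm]
  gcongr
  · simp
  · exact Finset.le_sup (f := Prod.fst) hp

theorem continuous_compSubConstCLM (u : 𝓢(E, ℂ)) :
    Continuous (fun x : E => compSubConstCLM ℂ x u) := by
  rw [continuous_iff_continuousAt]
  intro x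
  rw [ContinuousAt, (schwartz_withSeminorms ℝ E ℂ).tendsto_nhds]
  intro p ε hε
  obtain ⟨C, hC, h⟩ := exists_seminorm_compSubConstCLM_sub_le p.1 p.2 (compSubConstCLM ℂ x u)
  have hlim : Tendsto (fun y : E => C * ‖y - x‖) (𝓝 x) (𝓝 0) := by
    have : Continuous (fun y : E => C * ‖y - x‖) := by fun_prop
    simpa using this.tendsto x
  filter_upwards [hlim.eventually_lt_const hε, Metric.ball_mem_nhds x one_pos] with y hy hy1
  have := h (y - x) (by rw [Metric.mem_ball, dist_eq_norm] at hy1; exact hy1.le)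
  rw [compSubConstCLM_comp, add_sub_cancel] at this
  exact this.trans_lt hy

section Derivative

variable {E : Type*} [NormedAddCommGroup E] [InnerProductSpace ℝ E] [FiniteDimensional ℝ E]

/-- The derivative in direction `y` is `f (τ_x (-∂_y u))`, written in an orthonormal basis: its
components are again of the form `x ↦ f (τ_x v)`, which lets one iterate. -/
theorem hasFDerivAt_compSubConstCLM (f : 𝓢'(E, ℂ)) (u : 𝓢(E, ℂ)) (x : E) :
    HasFDerivAt (fun x : E => f (compSubConstCLM ℂ x u))
      (∑ i, (innerSL ℝ (stdOrthonormalBasis ℝ E i)).smulRight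
        (f (compSubConstCLM ℂ x (-∂_{stdOrthonormalBasis ℝ E i} u)))) x := by
  set b := stdOrthonormalBasis ℝ E
  set w := compSubConstCLM ℂ x u with hw
  have hL : ∀ y : E, (∑ i, (innerSL ℝ (b i)).smulRight
      (f (compSubConstCLM ℂ x (-∂_{b i} u)))) y = f (-∂_{y} w) := by
    intro y
    have h1 : (∂_{y} w : 𝓢(E, ℂ)) = ∑ i, inner ℝ (b i) y • compSubConstCLM ℂ x (∂_{b i} u) := by
      ext z
      have h2 : ∀ v : E, (∂_{v} w : 𝓢(E, ℂ)) z = (∂_{v} u : 𝓢(E, ℂ)) (z - x) := by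
        intro v
        rw [lineDerivOp_apply_eq_fderiv, lineDerivOp_apply_eq_fderiv]
        have : (⇑w) = fun z => u (z - x) := by ext; simp [hw]
        rw [this, fderiv_comp_sub]
      rw [h2]
      conv_lhs => rw [← b.sum_repr' y]
      rw [lineDerivOp_apply_eq_fderiv]
      simp [lineDerivOp_apply_eq_fderiv]
    rw [h1]
    simp only [_root_.sum_apply, ContinuousLinearMap.smulRight_apply, innerSL_apply_apply,
      map_neg, smul_neg, map_sum, Finset.sum_neg_distrib, neg_inj]
    congr 1
    ext i
    rw [← Complex.coe_smul, ← Complex.coe_smul, map_smul]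
  obtain ⟨s, C, hC, h⟩ := exists_norm_le_finsetSup_seminorm f
  choose c hc hcb using fun p : ℕ × ℕ => exists_seminorm_taylor_le p.1 p.2 w
  rw [hasFDerivAt_iff_isLittleO_nhds_zero]
  have hO : (fun y : E => f (compSubConstCLM ℂ (x + y) u) - f (compSubConstCLM ℂ x u) -
      (∑ i, (innerSL ℝ (b i)).smulRight (f (compSubConstCLM ℂ x (-∂_{b i} u)))) y)
      =O[𝓝 0] fun y => ‖y‖ ^ 2 := by
    refine Asymptotics.IsBigO.of_bound (C * ∑ p ∈ s, c p) ?_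
    filter_upwards [Metric.ball_mem_nhds (0 : E) one_pos] with y hy
    have hy : ‖y‖ ≤ 1 := by simpa using (Metric.mem_ball.1 hy).le
    rw [hL, ← compSubConstCLM_comp, ← map_sub, ← map_sub, sub_neg_eq_add]
    refine (h _).trans ?_
    rw [mul_assoc, norm_pow, norm_norm]
    refine mul_le_mul_of_nonneg_left ?_ hC
    exact finsetSup_le_sum _ _ _ _ hc (by positivity) (fun p _ => hcb p y hy)
  refine hO.trans_isLittleO ?_
  exact Asymptotics.isLittleO_norm_pow_id one_lt_two

/-- Averaging a tempered distribution against translates of a Schwartz function gives a smooth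
function of at most polynomial growth, together with all its derivatives. -/
theorem hasTemperateGrowth_compSubConstCLM (f : 𝓢'(E, ℂ)) (u : 𝓢(E, ℂ)) :
    (fun x : E => f (compSubConstCLM ℂ x u)).HasTemperateGrowth := by
  have hfd : ∀ u : 𝓢(E, ℂ), fderiv ℝ (fun x : E => f (compSubConstCLM ℂ x u)) =
      fun x => ∑ i, (innerSL ℝ (stdOrthonormalBasis ℝ E i)).smulRight
        (f (compSubConstCLM ℂ x (-∂_{stdOrthonormalBasis ℝ E i} u))) :=
    fun u => funext fun x => (hasFDerivAt_compSubConstCLM f u x).fderiv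
  have hd : ∀ u : 𝓢(E, ℂ), Differentiable ℝ (fun x : E => f (compSubConstCLM ℂ x u)) :=
    fun u x => (hasFDerivAt_compSubConstCLM f u x).differentiableAt
  have hsm : ∀ (n : ℕ) (u : 𝓢(E, ℂ)), ContDiff ℝ n (fun x : E => f (compSubConstCLM ℂ x u)) := by
    intro n
    induction n with
    | zero => exact fun u => contDiff_zero.2 (hd u).continuous
    | succ n ih =>
      intro u
      rw [show ((n + 1 : ℕ) : WithTop ℕ∞) = (n : WithTop ℕ∞) + 1 by norm_cast,
        contDiff_succ_iff_fderiv]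
      refine ⟨hd u, by simp, ?_⟩
      rw [hfd]
      exact ContDiff.sum fun i _ => (ContinuousLinearMap.smulRightL ℝ E ℂ
        (innerSL ℝ (stdOrthonormalBasis ℝ E i))).contDiff.comp (ih _)
  refine ⟨contDiff_infty.2 fun n => hsm n u, fun n => ?_⟩
  induction n generalizing u with
  | zero => simpa using exists_norm_compSubConstCLM_le f u
  | succ n ih =>
    choose k C h using fun i => ih (-∂_{stdOrthonormalBasis ℝ E i} u)
    refine ⟨Finset.univ.sup k, ∑ i, |C i|, fun x => ?_⟩
    rw [← norm_iteratedFDeriv_fderiv, hfd]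
    have hc : ∀ i, ContDiff ℝ n (fun x => (innerSL ℝ (stdOrthonormalBasis ℝ E i)).smulRight
        (f (compSubConstCLM ℂ x (-∂_{stdOrthonormalBasis ℝ E i} u)))) := fun i =>
      (ContinuousLinearMap.smulRightL ℝ E ℂ
        (innerSL ℝ (stdOrthonormalBasis ℝ E i))).contDiff.comp (hsm n _)
    rw [iteratedFDeriv_fun_sum_apply (fun i _ => (hc i).contDiffAt), Finset.sum_mul]
    refine (norm_sum_le _ _).trans (Finset.sum_le_sum fun i _ => ?_)
    have h1 := (ContinuousLinearMap.smulRightL ℝ E ℂ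
      (innerSL ℝ (stdOrthonormalBasis ℝ E i))).norm_iteratedFDeriv_comp_left
      (f := fun x => f (compSubConstCLM ℂ x (-∂_{stdOrthonormalBasis ℝ E i} u))) (x := x)
      (N := n) (n := n) (hsm n _).contDiffAt le_rfl
    have h2 : ‖ContinuousLinearMap.smulRightL ℝ E ℂ
        (innerSL ℝ (stdOrthonormalBasis ℝ E i))‖ ≤ 1 := by
      refine ContinuousLinearMap.opNorm_le_bound _ zero_le_one fun z => ?_
      simp [ContinuousLinearMap.norm_smulRight_apply]
    refine h1.trans ((mul_le_of_le_one_left (norm_nonneg _) h2).trans ((h i x).trans ?_))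
    gcongr
    · exact le_abs_self _
    · simp
    · exact Finset.le_sup (f := k) (Finset.mem_univ i)

end Derivative

end Regularization

/-! ### Weak integrals of Schwartz functions -/

section WeakIntegral

open LineDeriv SchwartzMap FourierTransform BoundedContinuousFunction

variable {E : Type*} [NormedAddCommGroup E] [NormedSpace ℝ E]

/-- The index set of the functionals `ψ ↦ |z|^m D^nψ(z)(v) / ∏ |v_i|`, `(m, n) ∈ s`, whose supremum
is the seminorm `max_{(m, n) ∈ s} p_{m, n}`. -/
def FunctionalIndex (E : Type*) (s : Finset (ℕ × ℕ)) : Type _ :=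
  Σ p : s, E × (Fin p.1.2 → E)

/-- The functional on Schwartz functions with a given index. -/
def functional {s : Finset (ℕ × ℕ)} (j : FunctionalIndex E s) (ψ : 𝓢(E, ℂ)) : ℂ :=
  (‖j.2.1‖ ^ j.1.1.1 * (∏ i, ‖j.2.2 i‖)⁻¹ : ℝ) • iteratedFDeriv ℝ j.1.1.2 ψ j.2.1 j.2.2

theorem norm_functional_le {s : Finset (ℕ × ℕ)} (j : FunctionalIndex E s) (ψ : 𝓢(E, ℂ)) :
    ‖functional j ψ‖ ≤ s.sup (fun p => SchwartzMap.seminorm ℝ p.1 p.2) ψ := by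
  obtain ⟨⟨p, hp⟩, z, v⟩ := j
  refine le_trans ?_ (Seminorm.le_finset_sup_apply (p := fun p : ℕ × ℕ =>
    SchwartzMap.seminorm ℝ (E := E) (F := ℂ) p.1 p.2) hp)
  refine le_trans ?_ (le_seminorm ℝ p.1 p.2 ψ z)
  simp only [functional]
  rw [norm_smul, Real.norm_of_nonneg (by positivity), mul_assoc]
  gcongr
  rcases eq_or_ne (∏ i, ‖v i‖) 0 with h | h
  · rw [h]; simp
  · rw [inv_mul_le_iff₀ (lt_of_le_of_ne (by positivity) h.symm), mul_comm]
    exact ContinuousMultilinearMap.le_opNorm _ _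

theorem finsetSup_seminorm_le_of_functional {s : Finset (ℕ × ℕ)} (ψ : 𝓢(E, ℂ)) {M : ℝ} (hM : 0 ≤ M)
    (h : ∀ j : FunctionalIndex E s, ‖functional j ψ‖ ≤ M) :
    s.sup (fun p => SchwartzMap.seminorm ℝ p.1 p.2) ψ ≤ M := by
  apply Seminorm.finset_sup_apply_le hM
  intro p hp
  apply seminorm_le_bound _ _ _ _ hM
  intro z
  rcases eq_or_ne (‖z‖ ^ p.1) 0 with h0 | h0
  · rw [h0, zero_mul]; exact hM
  have hpos : 0 < ‖z‖ ^ p.1 := lt_of_le_of_ne (by positivity) h0.symm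
  rw [← le_div_iff₀' hpos]
  apply ContinuousMultilinearMap.opNorm_le_bound (by positivity)
  intro v
  rcases eq_or_ne (∏ i, ‖v i‖) 0 with h1 | h1
  · have := (iteratedFDeriv ℝ p.2 ψ z).le_opNorm v
    rw [h1, mul_zero] at this ⊢
    exact this
  · have hpos1 : 0 < ∏ i, ‖v i‖ := lt_of_le_of_ne (by positivity) h1.symm
    have := h ⟨⟨p, hp⟩, z, v⟩
    simp only [functional] at this
    rw [norm_smul, Real.norm_of_nonneg (by positivity)] at this
    rw [div_mul_eq_mul_div, le_div_iff₀ hpos]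
    rw [mul_comm (‖z‖ ^ p.1), mul_assoc, inv_mul_le_iff₀ hpos1] at this
    linarith

open scoped Classical in
/-- Tempered distributions commute with weak integrals of continuous families of Schwartz functions
which are integrable in every Schwartz seminorm. The distribution factors through a space of bounded
functions, where by the Hahn--Banach theorem it extends to a continuous functional, and there the
weak integral is a Bochner integral. -/
theorem apply_eq_integral_of_forall_iteratedFDeriv {X : Type*} [TopologicalSpace X]
    [SecondCountableTopology X] [MeasurableSpace X] [OpensMeasurableSpace X] {μ : Measure X}
    (f : 𝓢'(E, ℂ)) (γ : X → 𝓢(E, ℂ)) (Γ : 𝓢(E, ℂ)) (hγ : Continuous γ)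
    (hint : ∀ m n : ℕ, Integrable (fun x => SchwartzMap.seminorm ℝ m n (γ x)) μ)
    (hΓ : ∀ (n : ℕ) (z : E) (v : Fin n → E),
      iteratedFDeriv ℝ n Γ z v = ∫ x, iteratedFDeriv ℝ n (γ x) z v ∂μ) :
    f Γ = ∫ x, f (γ x) ∂μ := by
  obtain ⟨s, C, hC, h⟩ := exists_norm_le_finsetSup_seminorm f
  let _ : TopologicalSpace (FunctionalIndex E s) := ⊥
  have _ : DiscreteTopology (FunctionalIndex E s) := ⟨rfl⟩
  set q : Seminorm ℝ 𝓢(E, ℂ) := s.sup (fun p => SchwartzMap.seminorm ℝ p.1 p.2)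
  have hadd : ∀ (j : FunctionalIndex E s) (ψ η : 𝓢(E, ℂ)),
      functional j (ψ + η) = functional j ψ + functional j η := by
    intro j ψ η
    simp only [functional]
    rw [FunLike.coe_add, iteratedFDeriv_add_apply (ψ.smooth _).contDiffAt (η.smooth _).contDiffAt,
      _root_.add_apply, smul_add]
  have hsmul : ∀ (j : FunctionalIndex E s) (c : ℂ) (ψ : 𝓢(E, ℂ)),
      functional j (c • ψ) = c • functional j ψ := by
    intro j c ψ
    simp only [functional]
    rw [FunLike.coe_smul, iteratedFDeriv_const_smul_apply (ψ.smooth _).contDiffAt,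
      _root_.smul_apply, smul_comm]
  -- `T` is isometric for the seminorm `q`, which controls `f`, so that `f` factors through it.
  let T : 𝓢(E, ℂ) →ₗ[ℂ] (FunctionalIndex E s →ᵇ ℂ) :=
    { toFun := fun ψ => ofNormedAddCommGroupDiscrete (fun j => functional j ψ) (q ψ)
        (fun j => norm_functional_le j ψ)
      map_add' := fun ψ η => by ext j; exact hadd j ψ η
      map_smul' := fun c ψ => by ext j; exact hsmul j c ψ }
  have hTapp : ∀ ψ j, T ψ j = functional j ψ := fun ψ j => rfl
  have hT1 : ∀ ψ, ‖T ψ‖ ≤ q ψ := fun ψ =>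
    (BoundedContinuousFunction.norm_le (apply_nonneg q ψ)).2 fun j => norm_functional_le j ψ
  have hT2 : ∀ ψ, q ψ ≤ ‖T ψ‖ := fun ψ =>
    finsetSup_seminorm_le_of_functional ψ (norm_nonneg _) fun j => (T ψ).norm_coe_le_norm j
  have hTc : Continuous (fun x => T (γ x)) := by
    rw [continuous_iff_continuousAt]
    intro x
    have h1 : Tendsto (fun y => q (γ y - γ x)) (𝓝 x) (𝓝 0) := by
      have h2 : Tendsto (fun y => ∑ p ∈ s, SchwartzMap.seminorm ℝ p.1 p.2 (γ y - γ x)) (𝓝 x)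
          (𝓝 0) := by
        have : Continuous
            (fun y => ∑ p ∈ s, SchwartzMap.seminorm ℝ p.1 p.2 (γ y - γ x)) :=
          continuous_finsetSum _ fun p _ =>
            ((schwartz_withSeminorms ℝ E ℂ).continuous_seminorm p).comp (hγ.sub continuous_const)
        simpa using this.tendsto x
      refine squeeze_zero (fun _ => apply_nonneg q _) (fun y => ?_) h2
      have := finsetSup_le_sum s (γ y - γ x)
        (fun p => SchwartzMap.seminorm ℝ p.1 p.2 (γ y - γ x)) 1
        (fun p => apply_nonneg _ _) zero_le_one (fun p _ => by simp)
      simpa using this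
    refine tendsto_iff_norm_sub_tendsto_zero.2 (squeeze_zero (fun _ => norm_nonneg _) ?_ h1)
    intro y
    rw [← map_sub]
    exact hT1 _
  have hTi : Integrable (fun x => T (γ x)) μ := by
    refine Integrable.mono' (integrable_finsetSum s fun p _ => hint p.1 p.2)
      hTc.aestronglyMeasurable (ae_of_all _ fun x => (hT1 _).trans ?_)
    have := finsetSup_le_sum s (γ x) (fun p => SchwartzMap.seminorm ℝ p.1 p.2 (γ x)) 1
      (fun p => apply_nonneg _ _) zero_le_one (fun p _ => by simp)
    simpa using this
  have hTΓ : T Γ = ∫ x, T (γ x) ∂μ := by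
    ext j
    have h1 := (BoundedContinuousFunction.evalCLM ℂ j).integral_comp_comm hTi
    rw [BoundedContinuousFunction.evalCLM_apply] at h1
    rw [← h1]
    simp only [BoundedContinuousFunction.evalCLM_apply, hTapp, functional]
    rw [integral_smul, hΓ]
  have hker : LinearMap.ker T ≤ LinearMap.ker (f : 𝓢(E, ℂ) →L[ℂ] ℂ).toLinearMap := by
    intro ψ hψ
    have h1 : ‖f ψ‖ ≤ 0 := (h ψ).trans (by
      have := hT2 ψ
      rw [LinearMap.mem_ker.1 hψ, norm_zero] at this
      exact mul_nonpos_of_nonneg_of_nonpos hC this)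
    exact norm_le_zero_iff.1 h1
  let Λ₀ : LinearMap.range T →ₗ[ℂ] ℂ :=
    ((LinearMap.ker T).liftQ (f : 𝓢(E, ℂ) →L[ℂ] ℂ).toLinearMap hker) ∘ₗ
      (T.quotKerEquivRange.symm : LinearMap.range T →ₗ[ℂ] _)
  have hΛ₀ : ∀ ψ, Λ₀ ⟨T ψ, LinearMap.mem_range_self T ψ⟩ = f ψ := by
    intro ψ
    simp only [Λ₀, LinearMap.comp_apply, LinearEquiv.coe_coe]
    rw [LinearMap.quotKerEquivRange_symm_apply_image]
    rfl
  have hΛb : ∀ y : LinearMap.range T, ‖Λ₀ y‖ ≤ C * ‖y‖ := by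
    rintro ⟨_, ψ, rfl⟩
    rw [hΛ₀]
    exact (h ψ).trans (mul_le_mul_of_nonneg_left (hT2 ψ) hC)
  obtain ⟨Λ, hΛ, -⟩ := exists_extension_norm_eq _ (Λ₀.mkContinuous C hΛb)
  have hfac : ∀ ψ, f ψ = Λ (T ψ) := fun ψ => by
    rw [← hΛ₀ ψ]
    exact (hΛ ⟨T ψ, LinearMap.mem_range_self T ψ⟩).symm
  rw [hfac, hTΓ, ← Λ.integral_comp_comm hTi]
  simp only [hfac]

end WeakIntegral

/-! ### Convolution of Schwartz functions and distributions -/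

section Convolution

open LineDeriv SchwartzMap FourierTransform

variable {E : Type*} [NormedAddCommGroup E] [InnerProductSpace ℝ E] [FiniteDimensional ℝ E]
  [MeasurableSpace E] [BorelSpace E]

theorem fourier_injective {u w : 𝓢(E, ℂ)} (h : 𝓕 u = 𝓕 w) : u = w := by
  have := congrArg (fun w : 𝓢(E, ℂ) => (𝓕⁻ w : 𝓢(E, ℂ))) h
  simpa using this

theorem lineDerivOp_convolution (ψ k : 𝓢(E, ℂ)) (y : E) :
    ∂_{y} (convolution (ContinuousLinearMap.mul ℂ ℂ) ψ k) =
      convolution (ContinuousLinearMap.mul ℂ ℂ) ψ (∂_{y} k) := by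
  have h : 𝓕 (∂_{y} (convolution (ContinuousLinearMap.mul ℂ ℂ) ψ k)) =
      𝓕 (convolution (ContinuousLinearMap.mul ℂ ℂ) ψ (∂_{y} k)) := by
    rw [fourier_lineDerivOp_eq, fourier_convolution, fourier_convolution, fourier_lineDerivOp_eq]
    have ht : (inner ℝ · y : E → ℝ).HasTemperateGrowth := by fun_prop
    ext ξ
    simp [smulLeftCLM_apply_apply ht]
    ring
  exact fourier_injective h

theorem iteratedLineDerivOp_convolution {n : ℕ} (ψ k : 𝓢(E, ℂ)) (v : Fin n → E) :
    ∂^{v} (convolution (ContinuousLinearMap.mul ℂ ℂ) ψ k) =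
      convolution (ContinuousLinearMap.mul ℂ ℂ) ψ (∂^{v} k) := by
  induction n with
  | zero => simp
  | succ n ih =>
    rw [iteratedLineDerivOp_succ_left, iteratedLineDerivOp_succ_left, ih, lineDerivOp_convolution]

theorem convolution_mul_apply (ψ k : 𝓢(E, ℂ)) (z : E) :
    convolution (ContinuousLinearMap.mul ℂ ℂ) ψ k z = ∫ x, ψ x * k (z - x) := by
  rw [convolution_apply]
  rfl

/-- The transpose of the Fourier multiplier `m(D)` is the convolution with `𝓕 m`. -/
theorem fourier_smulLeftCLM_fourierInv (m ψ : 𝓢(E, ℂ)) :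
    𝓕 (smulLeftCLM ℂ m (𝓕⁻ ψ)) = convolution (ContinuousLinearMap.mul ℂ ℂ) ψ (𝓕 m) := by
  have hff : ∀ (u : 𝓢(E, ℂ)) (ξ : E), 𝓕 (𝓕 u) ξ = u (-ξ) := by
    intro u ξ
    have h := congrArg (fun w : 𝓢(E, ℂ) => w (-ξ))
      (FourierTransform.fourierInv_fourier_eq (E := 𝓢(E, ℂ)) (F := 𝓢(E, ℂ)) u)
    simp only [fourierInv_apply_eq] at h
    simpa using h
  have h : 𝓕 (𝓕 (smulLeftCLM ℂ m (𝓕⁻ ψ))) =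
      𝓕 (convolution (ContinuousLinearMap.mul ℂ ℂ) ψ (𝓕 m)) := by
    rw [fourier_convolution]
    ext ξ
    rw [hff, smulLeftCLM_apply_apply m.hasTemperateGrowth, pairing_apply_apply, hff,
      fourierInv_apply_eq]
    simp [mul_comm]
  exact fourier_injective h

/-- A distribution applied to a convolution is a superposition of its values on translates. -/
theorem apply_convolution (f : 𝓢'(E, ℂ)) (ψ k : 𝓢(E, ℂ)) :
    f (convolution (ContinuousLinearMap.mul ℂ ℂ) ψ k) =
      ∫ x, ψ x • f (compSubConstCLM ℂ x k) := by
  have h1 : ∀ x, ψ x • f (compSubConstCLM ℂ x k) = f (ψ x • compSubConstCLM ℂ x k) :=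
    fun x => (map_smul f _ _).symm
  simp_rw [h1]
  have hcont : Continuous fun x => ψ x • compSubConstCLM ℂ x k :=
    ψ.continuous.smul (continuous_compSubConstCLM k)
  apply apply_eq_integral_of_forall_iteratedFDeriv f _ _ hcont
  · intro m n
    have hs : Continuous (SchwartzMap.seminorm ℝ (E := E) (F := ℂ) m n) :=
      (schwartz_withSeminorms ℝ E ℂ).continuous_seminorm (m, n)
    set C := (2 ^ m * (Finset.Iic (m, n)).sup (fun p => SchwartzMap.seminorm ℝ p.1 p.2) k)
    have hi : Integrable (fun x : E => C * (2 ^ m * (‖ψ x‖ + ‖x‖ ^ m * ‖ψ x‖))) :=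
      ((ψ.integrable.norm.add (ψ.integrable_pow_mul volume m)).const_mul _).const_mul _
    refine hi.mono' (hs.comp hcont).aestronglyMeasurable (ae_of_all _ fun x => ?_)
    rw [Real.norm_of_nonneg (apply_nonneg _ _)]
    have h2 : SchwartzMap.seminorm ℝ m n (ψ x • compSubConstCLM ℂ x k) =
        ‖ψ x‖ * SchwartzMap.seminorm ℝ m n (compSubConstCLM ℂ x k) :=
      map_smul_eq_mul (SchwartzMap.seminorm ℂ m n) (ψ x) _
    rw [h2]
    have h3 := seminorm_compSubConstCLM_le m n k x
    have h4 : (1 + ‖x‖) ^ m ≤ 2 ^ m * (1 + ‖x‖ ^ m) := by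
      have := add_pow_le (zero_le_one' ℝ) (norm_nonneg x) m
      rw [one_pow] at this
      refine this.trans ?_
      gcongr
      · norm_num
      · exact Nat.sub_le m 1
    have hC : 0 ≤ C := by positivity
    calc ‖ψ x‖ * SchwartzMap.seminorm ℝ m n (compSubConstCLM ℂ x k)
        ≤ ‖ψ x‖ * ((2 ^ m * (1 + ‖x‖ ^ m)) * C) := by
          gcongr
          exact h3.trans (mul_le_mul_of_nonneg_right h4 hC)
      _ = _ := by ring
  · intro n z v
    rw [← iteratedLineDerivOp_eq_iteratedFDeriv, iteratedLineDerivOp_convolution,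
      convolution_mul_apply]
    congr 1
    ext x
    rw [FunLike.coe_smul, iteratedFDeriv_const_smul_apply
      ((compSubConstCLM ℂ x k).smooth _).contDiffAt, iteratedFDeriv_compSubConstCLM,
      _root_.smul_apply, ← iteratedLineDerivOp_eq_iteratedFDeriv, smul_eq_mul]

end Convolution

/-! ### The smooth representative of a frequency-localized distribution -/

section Representative

open LineDeriv SchwartzMap FourierTransform

variable {E : Type*} [NormedAddCommGroup E] [InnerProductSpace ℝ E] [FiniteDimensional ℝ E]
  [MeasurableSpace E] [BorelSpace E]

/-- The smooth function which represents the tempered distribution `m(D) f`, for a Schwartz symbol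
`m`. At `x` it is the value of `f` at the translate by `x` of the Fourier transform of `m`. -/
def smoothRep (m : 𝓢(E, ℂ)) (f : 𝓢'(E, ℂ)) (x : E) : ℂ :=
  f (compSubConstCLM ℂ x (𝓕 m))

theorem hasTemperateGrowth_smoothRep (m : 𝓢(E, ℂ)) (f : 𝓢'(E, ℂ)) :
    (smoothRep m f).HasTemperateGrowth :=
  hasTemperateGrowth_compSubConstCLM f (𝓕 m)

theorem toTemperedDistribution_smoothRep (m : 𝓢(E, ℂ)) (f : 𝓢'(E, ℂ)) :
    (hasTemperateGrowth_smoothRep m f).toTemperedDistribution volume =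
      TemperedDistribution.fourierMultiplierCLM ℂ m f := by
  ext ψ
  rw [TemperedDistribution.fourierMultiplierCLM_apply_apply, fourier_smulLeftCLM_fourierInv,
    apply_convolution]
  rfl

end Representative

open TemperedDistribution FourierTransform

/-! ### Smooth functions as tempered distributions -/

theorem represents_smoothRep (m : 𝓢(R3, ℂ)) (f : Distr) :
    Represents (smoothRep m f) (fourierMultiplierCLM ℂ m f) :=
  ⟨hasTemperateGrowth_smoothRep m f, toTemperedDistribution_smoothRep m f⟩

namespace Represents

variable {g h : R3 → ℂ} {f u : Distr}

theorem apply (H : Represents g f) (ψ : 𝓢(R3, ℂ)) : f ψ = ∫ x, ψ x * g x := by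
  obtain ⟨hg, rfl⟩ := H
  simp

theorem hasTemperateGrowth (H : Represents g f) : g.HasTemperateGrowth := H.1

theorem continuous (H : Represents g f) : Continuous g := H.1.1.continuous

theorem of_apply (hg : g.HasTemperateGrowth) (h : ∀ ψ : 𝓢(R3, ℂ), f ψ = ∫ x, ψ x * g x) :
    Represents g f := by
  refine ⟨hg, ?_⟩
  ext ψ
  rw [h]
  simp

theorem integrable (hg : g.HasTemperateGrowth) (ψ : 𝓢(R3, ℂ)) :
    Integrable (fun x => ψ x * g x) := by
  have := (SchwartzMap.smulLeftCLM ℂ g ψ).integrable (μ := volume)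
  refine this.congr (ae_of_all _ fun x => ?_)
  simp [SchwartzMap.smulLeftCLM_apply_apply hg, mul_comm]

theorem add (H : Represents g f) (H' : Represents h u) : Represents (g + h) (f + u) := by
  refine of_apply (H.1.add H'.1) fun ψ => ?_
  rw [_root_.add_apply, H.apply, H'.apply, ← integral_add (integrable H.1 ψ) (integrable H'.1 ψ)]
  simp [mul_add]

theorem sub (H : Represents g f) (H' : Represents h u) : Represents (g - h) (f - u) := by
  refine of_apply (H.1.sub H'.1) fun ψ => ?_
  rw [_root_.sub_apply, H.apply, H'.apply, ← integral_sub (integrable H.1 ψ) (integrable H'.1 ψ)]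
  simp [mul_sub]

theorem mul (H : Represents g f) (hh : h.HasTemperateGrowth) :
    Represents (h * g) (smulLeftCLM ℂ h f) := by
  refine of_apply (hh.mul H.1) fun ψ => ?_
  rw [smulLeftCLM_apply_apply, H.apply]
  congr 1
  ext x
  simp [SchwartzMap.smulLeftCLM_apply_apply hh]
  ring

theorem ae_eq {p : ℝ≥0∞} [Fact (1 ≤ p)] (H : Represents g f)
    (F : Lp ℂ p (volume : Measure R3)) (hF : Lp.toTemperedDistribution F = f) : F =ᵐ[volume] g := by
  have hFl : LocallyIntegrable F volume := (Lp.memLp F).locallyIntegrable Fact.out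
  have hgl : LocallyIntegrable g volume := H.continuous.locallyIntegrable
  have key : ∀ᵐ x, (⇑F - g) x = 0 := by
    apply ae_eq_zero_of_integral_contDiff_smul_eq_zero (hFl.sub hgl)
    intro η hη hηc
    have h1 : HasCompactSupport (Complex.ofRealCLM ∘ η) := hηc.comp_left rfl
    have h2 : ContDiff ℝ ∞ (Complex.ofRealCLM ∘ η) := by fun_prop
    have h3 : Lp.toTemperedDistribution F (h1.toSchwartzMap h2) = f (h1.toSchwartzMap h2) := by
      rw [hF]
    rw [Lp.toTemperedDistribution_apply, H.apply] at h3
    have e : ∀ x, η x • (⇑F - g) x = η x • F x - η x • g x := fun x => by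
      simp [mul_sub]
    simp_rw [e]
    rw [integral_sub]
    · rw [sub_eq_zero]
      simpa using h3
    · exact hFl.integrable_smul_left_of_hasCompactSupport hη.continuous hηc
    · exact hgl.integrable_smul_left_of_hasCompactSupport hη.continuous hηc
  filter_upwards [key] with x hx
  exact sub_eq_zero.1 hx

theorem unique (H : Represents g f) (H' : Represents h f) : g = h := by
  have key : ∀ᵐ x, (g - h) x = 0 := by
    apply ae_eq_zero_of_integral_contDiff_smul_eq_zero
      (H.continuous.sub H'.continuous).locallyIntegrable
    intro η hη hηc
    have h1 : HasCompactSupport (Complex.ofRealCLM ∘ η) := hηc.comp_left rfl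
    have h2 : ContDiff ℝ ∞ (Complex.ofRealCLM ∘ η) := by fun_prop
    have h3 := (H.sub H').apply (h1.toSchwartzMap h2)
    rw [sub_self, _root_.zero_apply] at h3
    simpa using h3.symm
  have := Continuous.ae_eq_iff_eq volume H.continuous H'.continuous
  apply this.1
  filter_upwards [key] with x hx
  exact sub_eq_zero.1 hx

end Represents

/-- The product of two smooth functions does not depend on which of them is regarded as a
distribution. -/
theorem smulLeftCLM_comm_of_represents {g₁ g₂ : R3 → ℂ} {f₁ f₂ : Distr} (H₁ : Represents g₁ f₁)
    (H₂ : Represents g₂ f₂) : smulLeftCLM ℂ g₁ f₂ = smulLeftCLM ℂ g₂ f₁ := by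
  obtain ⟨h, e⟩ := H₂.mul H₁.1
  obtain ⟨h', e'⟩ := H₁.mul H₂.1
  rw [← e, ← e']
  simp_rw [mul_comm g₂ g₁]

/-! ### The `L^p` norm of a tempered distribution -/

section LpNorm

variable {p : ℝ≥0∞} [Fact (1 ≤ p)]

theorem toTemperedDistribution_injective :
    Function.Injective (Lp.toTemperedDistribution : Lp ℂ p (volume : Measure R3) → Distr) := by
  have := Lp.ker_toTemperedDistributionCLM_eq_bot (F := ℂ) (E := R3) (μ := volume) (p := p)
  exact LinearMap.ker_eq_bot.1 this

@[simp]
theorem lpNorm_toTemperedDistribution (F : Lp ℂ p (volume : Measure R3)) :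
    lpNorm p (Lp.toTemperedDistribution F) = ‖F‖ₑ := by
  refine le_antisymm (iInf₂_le (f := fun (G : Lp ℂ p (volume : Measure R3))
    (_ : Lp.toTemperedDistribution G = Lp.toTemperedDistribution F) => ‖G‖ₑ) F rfl)
    (le_iInf₂ fun G hG => ?_)
  rw [toTemperedDistribution_injective hG]

theorem exists_of_lpNorm_ne_top {f : Distr} (h : lpNorm p f ≠ ⊤) :
    ∃ F : Lp ℂ p (volume : Measure R3), Lp.toTemperedDistribution F = f := by
  by_contra hne
  push Not at hne
  exact h (iInf₂_eq_top.2 fun G hG => absurd hG (hne G))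

theorem lpNorm_le_eLpNorm {g : R3 → ℂ} {f : Distr} (H : Represents g f) :
    lpNorm p f ≤ eLpNorm g p volume := by
  by_cases hg : eLpNorm g p volume = ⊤
  · rw [hg]; exact le_top
  have hm : MemLp g p volume := ⟨H.continuous.aestronglyMeasurable, lt_top_iff_ne_top.2 hg⟩
  refine (iInf₂_le (hm.toLp g) ?_).trans (by rw [Lp.enorm_toLp])
  ext ψ
  rw [H.apply, Lp.toTemperedDistribution_apply]
  apply integral_congr_ae
  filter_upwards [hm.coeFn_toLp] with x hx
  rw [hx, smul_eq_mul]

theorem lpNorm_eq_eLpNorm {g : R3 → ℂ} {f : Distr} (H : Represents g f) :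
    lpNorm p f = eLpNorm g p volume := by
  refine le_antisymm (lpNorm_le_eLpNorm H) (le_iInf₂ fun G hG => ?_)
  rw [Lp.enorm_def, eLpNorm_congr_ae (H.ae_eq G hG)]

/-- By continuity of `g` the essential supremum is a pointwise bound. -/
theorem enorm_le_lpNorm_top {g : R3 → ℂ} {f : Distr} (H : Represents g f) (x : R3) :
    ‖g x‖ₑ ≤ lpNorm ⊤ f := by
  rw [lpNorm_eq_eLpNorm H, eLpNorm_exponent_top]
  have h1 : ∀ᵐ y, ‖g y‖ₑ ≤ eLpNormEssSup g volume := ae_le_eLpNormEssSup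
  have hcl : IsClosed {y | ‖g y‖ₑ ≤ eLpNormEssSup g volume} :=
    isClosed_le H.continuous.enorm continuous_const
  have := Measure.dense_of_ae h1
  have hx : x ∈ closure {y | ‖g y‖ₑ ≤ eLpNormEssSup g volume} := this x
  rw [hcl.closure_eq] at hx
  exact hx

theorem lpNorm_zero : lpNorm p (0 : Distr) = 0 := by
  refine le_antisymm ((iInf₂_le 0 ?_).trans (by simp)) zero_le
  exact (Lp.toTemperedDistributionCLM ℂ (volume : Measure R3) p).map_zero

theorem lpNorm_add_le (f g : Distr) : lpNorm p (f + g) ≤ lpNorm p f + lpNorm p g := by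
  by_cases hf : lpNorm p f = ⊤
  · simp [hf]
  by_cases hg : lpNorm p g = ⊤
  · simp [hg]
  obtain ⟨F, rfl⟩ := exists_of_lpNorm_ne_top hf
  obtain ⟨G, rfl⟩ := exists_of_lpNorm_ne_top hg
  have : Lp.toTemperedDistribution F + Lp.toTemperedDistribution G =
      Lp.toTemperedDistribution (F + G) :=
    ((Lp.toTemperedDistributionCLM ℂ (volume : Measure R3) p).map_add F G).symm
  rw [this]
  simp only [lpNorm_toTemperedDistribution]
  exact enorm_add_le F G

theorem lpNorm_neg (f : Distr) : lpNorm p (-f) = lpNorm p f := by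
  have h : ∀ f : Distr, lpNorm p (-f) ≤ lpNorm p f := by
    intro f
    refine le_iInf₂ fun F hF => (iInf₂_le (-F) ?_).trans (by rw [enorm_neg])
    rw [← hF]
    exact (Lp.toTemperedDistributionCLM ℂ (volume : Measure R3) p).map_neg F
  exact le_antisymm (h f) (by simpa using h (-f))

theorem lpNorm_sub_le (f g : Distr) : lpNorm p (f - g) ≤ lpNorm p f + lpNorm p g := by
  rw [sub_eq_add_neg, ← lpNorm_neg g]
  exact lpNorm_add_le _ _

theorem lpNorm_sum_le {ι : Type*} (s : Finset ι) (f : ι → Distr) :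
    lpNorm p (∑ i ∈ s, f i) ≤ ∑ i ∈ s, lpNorm p (f i) := by
  classical
  induction s using Finset.induction_on with
  | empty => simp [lpNorm_zero]
  | insert a s ha ih =>
    rw [Finset.sum_insert ha, Finset.sum_insert ha]
    exact (lpNorm_add_le _ _).trans (by gcongr)

theorem eq_zero_of_lpNorm_eq_zero {f : Distr} (h : lpNorm p f = 0) : f = 0 := by
  obtain ⟨F, rfl⟩ := exists_of_lpNorm_ne_top (p := p) (f := f) (by simp [h])
  rw [lpNorm_toTemperedDistribution, enorm_eq_zero] at h
  rw [h]
  exact (Lp.toTemperedDistributionCLM ℂ (volume : Measure R3) p).map_zero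

theorem lpNorm_smulLeftCLM_le {g : R3 → ℂ} (hg : g.HasTemperateGrowth) {M : ℝ≥0∞}
    (hM : ∀ x, ‖g x‖ₑ ≤ M) (f : Distr) :
    lpNorm p (smulLeftCLM ℂ g f) ≤ M * lpNorm p f := by
  -- The two degenerate cases in which `∞ * 0` could occur on the right-hand side come first.
  rcases eq_or_ne (lpNorm p f) 0 with h0 | h0
  · rw [eq_zero_of_lpNorm_eq_zero h0]
    simp [lpNorm_zero]
  rcases eq_or_ne M 0 with hM0 | hM0
  · have : g = fun _ => 0 := by
      ext x
      simpa [hM0] using hM x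
    have h1 : smulLeftCLM ℂ g f = 0 := by
      ext ψ
      simp [this]
    rw [h1, lpNorm_zero]
    exact zero_le
  rcases eq_or_ne M ⊤ with hMt | hMt
  · rw [hMt, ENNReal.top_mul h0]; exact le_top
  by_cases hf : lpNorm p f = ⊤
  · rw [hf, ENNReal.mul_top hM0]; exact le_top
  obtain ⟨F, rfl⟩ := exists_of_lpNorm_ne_top hf
  have hg' : MemLp g ⊤ volume := by
    refine ⟨hg.1.continuous.aestronglyMeasurable, ?_⟩
    rw [eLpNorm_exponent_top]
    exact (eLpNormEssSup_le_of_ae_enorm_bound (ae_of_all _ hM)).trans_lt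
      (lt_top_iff_ne_top.2 hMt)
  rw [← Lp.toTemperedDistribution_smul_eq (p := ⊤) (q := p) (r := p) hg hg' F]
  simp only [lpNorm_toTemperedDistribution]
  rw [Lp.enorm_def, Lp.enorm_def]
  refine eLpNorm_le_mul_eLpNorm_of_ae_le_mul'' p (Lp.aestronglyMeasurable F) ?_
  filter_upwards [Lp.coeFn_lpSMul (r := p) (hg'.toLp _) F, hg'.coeFn_toLp] with x h1 h2
  rw [h1, Pi.smul_apply', h2, smul_eq_mul, enorm_mul]
  gcongr
  exact hM x

end LpNorm

/-! ### Square-integrable distributions -/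

theorem lpNorm_two_fourier_le (f : Distr) : lpNorm 2 (𝓕 f : Distr) ≤ lpNorm 2 f := by
  refine le_iInf₂ fun F hF => (iInf₂_le (𝓕 F) ?_).trans ?_
  · rw [← hF, Lp.fourier_toTemperedDistribution_eq]
  · rw [enorm_eq_iff_norm_eq.2 (Lp.norm_fourier_eq F)]

theorem lpNorm_two_fourierInv_le (f : Distr) : lpNorm 2 (𝓕⁻ f : Distr) ≤ lpNorm 2 f := by
  refine le_iInf₂ fun F hF => (iInf₂_le (𝓕⁻ F) ?_).trans ?_
  · rw [← hF, Lp.fourierInv_toTemperedDistribution_eq]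
  · have := Lp.norm_fourier_eq (𝓕⁻ F)
    rw [FourierTransform.fourier_fourierInv_eq] at this
    rw [enorm_eq_iff_norm_eq.2 this]

/-- Plancherel: a Fourier multiplier is bounded on `L²` by the supremum of its symbol. -/
theorem lpNorm_two_fourierMultiplierCLM_le {m : R3 → ℂ} (hm : m.HasTemperateGrowth) {M : ℝ≥0∞}
    (hM : ∀ ξ, ‖m ξ‖ₑ ≤ M) (f : Distr) :
    lpNorm 2 (fourierMultiplierCLM ℂ m f) ≤ M * lpNorm 2 f := by
  rw [fourierMultiplierCLM_apply]
  refine (lpNorm_two_fourierInv_le _).trans ((lpNorm_smulLeftCLM_le hm hM _).trans ?_)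
  gcongr
  exact lpNorm_two_fourier_le f

theorem norm_star_Lp (F : Lp ℂ 2 (volume : Measure R3)) : ‖star F‖ = ‖F‖ := by
  rw [Lp.norm_def, Lp.norm_def, eLpNorm_congr_ae (Lp.coeFn_star F)]
  congr 1
  exact eLpNorm_congr_norm_ae (ae_of_all _ fun x => by simp)

theorem enorm_apply_le_lpNorm_two_mul (f : Distr) (ψ : 𝓢(R3, ℂ)) (hf : lpNorm 2 f ≠ ⊤) :
    ‖f ψ‖ₑ ≤ lpNorm 2 f * ‖ψ.toLp 2 (volume : Measure R3)‖ₑ := by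
  obtain ⟨F, rfl⟩ := exists_of_lpNorm_ne_top hf
  rw [lpNorm_toTemperedDistribution]
  have h1 : Lp.toTemperedDistribution F ψ =
      inner ℂ (star F) (ψ.toLp 2 (volume : Measure R3)) := by
    rw [Lp.toTemperedDistribution_apply, L2.inner_def]
    apply integral_congr_ae
    filter_upwards [Lp.coeFn_star F, ψ.coeFn_toLp 2 volume] with x h1 h2
    rw [h1, h2]
    simp [mul_comm]
  rw [h1, ← ofReal_norm, ← ofReal_norm, ← ofReal_norm, ← ENNReal.ofReal_mul (norm_nonneg _)]
  refine ENNReal.ofReal_le_ofReal ((norm_inner_le_norm _ _).trans ?_)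
  rw [norm_star_Lp]

/-- The `L²` norm is determined by duality with Schwartz functions. -/
theorem lpNorm_two_le_of_forall_apply_le (f : Distr) (M : ℝ≥0)
    (h : ∀ ψ : 𝓢(R3, ℂ), ‖f ψ‖ ≤ M * ‖ψ.toLp 2 (volume : Measure R3)‖) : lpNorm 2 f ≤ M := by
  have hd : DenseRange (SchwartzMap.toLpCLM ℂ (E := R3) ℂ 2 volume) :=
    SchwartzMap.denseRange_toLpCLM (p := 2) ENNReal.ofNat_ne_top
  let fl : 𝓢(R3, ℂ) →ₗ[ℂ] ℂ := (f : 𝓢(R3, ℂ) →L[ℂ] ℂ).toLinearMap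
  let e : 𝓢(R3, ℂ) →ₗ[ℂ] Lp ℂ 2 (volume : Measure R3) :=
    (SchwartzMap.toLpCLM ℂ (E := R3) ℂ 2 volume).toLinearMap
  have hb : ∀ ψ, ‖fl ψ‖ ≤ M * ‖e ψ‖ := h
  let Λ : Lp ℂ 2 (volume : Measure R3) →L[ℂ] ℂ := fl.extendOfNorm e
  have hΛ : ∀ ψ, Λ (e ψ) = f ψ := LinearMap.extendOfNorm_eq hd ⟨M, hb⟩
  have hΛn : ‖Λ‖ ≤ M := LinearMap.opNorm_extendOfNorm_le hd M.2 hb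
  let H := (InnerProductSpace.toDual ℂ (Lp ℂ 2 (volume : Measure R3))).symm Λ
  have hH : ∀ G, inner ℂ H G = Λ G := fun G => InnerProductSpace.toDual_symm_apply
  have hf : Lp.toTemperedDistribution (star H) = f := by
    ext ψ
    rw [← hΛ ψ, ← hH, Lp.toTemperedDistribution_apply, L2.inner_def]
    apply integral_congr_ae
    filter_upwards [Lp.coeFn_star H, ψ.coeFn_toLp 2 volume] with x h1 h2
    have h3 : (e ψ : R3 → ℂ) x = ψ x := h2
    rw [h1, h3]
    simp
  rw [← hf, lpNorm_toTemperedDistribution, ← ofReal_norm, norm_star_Lp]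
  refine (ENNReal.ofReal_le_ofReal ((LinearIsometryEquiv.norm_map _ _).le.trans hΛn)).trans ?_
  simp

/-- Lower semicontinuity of the `L²` norm along limits of tempered distributions. -/
theorem lpNorm_two_le_of_tendsto {ι : Type*} {l : Filter ι} [l.NeBot] {F : ι → Distr} {f : Distr}
    {M : ℝ≥0∞} (hF : Tendsto F l (𝓝 f)) (h : ∀ᶠ i in l, lpNorm 2 (F i) ≤ M) : lpNorm 2 f ≤ M := by
  rcases eq_or_ne M ⊤ with hM | hM
  · rw [hM]; exact le_top
  lift M to ℝ≥0 using hM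
  refine lpNorm_two_le_of_forall_apply_le f M fun ψ => ?_
  have h1 := (PointwiseConvergenceCLM.tendsto_iff_forall_tendsto.1 hF ψ).norm
  refine le_of_tendsto h1 ?_
  filter_upwards [h] with i hi
  have h2 := enorm_apply_le_lpNorm_two_mul (F i) ψ (ne_top_of_le_ne_top ENNReal.coe_ne_top hi)
  have h3 : ‖F i ψ‖ₑ ≤ M * ‖ψ.toLp 2 (volume : Measure R3)‖ₑ := h2.trans (by gcongr)
  rw [← ofReal_norm, ← ofReal_norm, ← ENNReal.ofReal_coe_nnreal (p := M),
    ← ENNReal.ofReal_mul (NNReal.coe_nonneg M)] at h3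
  exact (ENNReal.ofReal_le_ofReal_iff (by positivity)).1 h3

/-! ### Frequency localization of products -/

section Spectrum

variable {E : Type*} [NormedAddCommGroup E] [InnerProductSpace ℝ E] [FiniteDimensional ℝ E]
  [MeasurableSpace E] [BorelSpace E]

/-- Translating a Schwartz function by `-η` modulates its Fourier transform. -/
theorem fourier_compSubConstCLM_apply (u : 𝓢(E, ℂ)) (η x : E) :
    𝓕 (SchwartzMap.compSubConstCLM ℂ (-η) u) x = Real.fourierChar (inner ℝ x η) • 𝓕 u x := by
  rw [SchwartzMap.fourier_coe, SchwartzMap.fourier_coe]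
  have : (⇑(SchwartzMap.compSubConstCLM ℂ (-η) u)) = ⇑u ∘ fun v => v + η := by
    ext v; simp
  rw [this]
  have h := congrFun (VectorFourier.fourierIntegral_comp_add_right Real.fourierChar volume
    (innerₗ E) u η) x
  rw [real_inner_comm]
  exact h

/-- The spectrum of a product lies in the sum of the spectra: if the symbols satisfy
`m₁(ξ) m₂(η) m₃(ξ + η) = 0`, then `m₃(D)(m₁(D)b · m₂(D)a) = 0`. -/
theorem fourierMultiplierCLM_smulLeftCLM_smoothRep_eq_zero (m₁ : 𝓢(E, ℂ)) {m₂ m₃ : E → ℂ}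
    (h₂ : m₂.HasTemperateGrowth) (h₃ : m₃.HasTemperateGrowth)
    (h : ∀ ξ η, m₂ η ≠ 0 → m₃ (ξ + η) ≠ 0 → m₁ ξ = 0) (b a : 𝓢'(E, ℂ)) :
    fourierMultiplierCLM ℂ m₃
      (smulLeftCLM ℂ (smoothRep m₁ b) (fourierMultiplierCLM ℂ m₂ a)) = 0 := by
  ext ψ
  rw [fourierMultiplierCLM_apply_apply, smulLeftCLM_apply_apply, fourierMultiplierCLM_apply_apply,
    _root_.zero_apply]
  set w := SchwartzMap.smulLeftCLM ℂ m₃ (𝓕⁻ ψ) with hw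
  have hσ := hasTemperateGrowth_smoothRep m₁ b
  suffices hz : SchwartzMap.smulLeftCLM ℂ m₂ (𝓕⁻ (SchwartzMap.smulLeftCLM ℂ (smoothRep m₁ b) (𝓕 w)))
      = 0 by
    rw [hz]
    have : (𝓕 (0 : 𝓢(E, ℂ)) : 𝓢(E, ℂ)) = 0 := (fourierCLM ℂ 𝓢(E, ℂ)).map_zero
    rw [this, map_zero]
  ext η
  rw [SchwartzMap.smulLeftCLM_apply_apply h₂, _root_.zero_apply, smul_eq_mul]
  by_cases hη : m₂ η = 0
  · rw [hη, zero_mul]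
  apply mul_eq_zero_of_right
  -- The Fourier transform of a product with `m₁(D) b`, at the frequency `η`, is `m₁(D) b` tested
  -- against a modulated Schwartz function, whose spectrum does not meet the support of `m₁`.
  set Θ := 𝓕 (SchwartzMap.compSubConstCLM ℂ (-η) w) with hΘ
  have h1 : 𝓕⁻ (SchwartzMap.smulLeftCLM ℂ (smoothRep m₁ b) (𝓕 w)) η =
      fourierMultiplierCLM ℂ m₁ b Θ := by
    rw [← toTemperedDistribution_smoothRep]
    refine Eq.trans ?_
      (Function.HasTemperateGrowth.toTemperedDistribution_apply volume hσ Θ).symm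
    rw [SchwartzMap.fourierInv_coe, Real.fourierInv_eq]
    congr 1
    ext x
    rw [hΘ, fourier_compSubConstCLM_apply, SchwartzMap.smulLeftCLM_apply_apply hσ, smul_assoc,
      smul_eq_mul, smul_eq_mul, mul_comm (𝓕 w x)]
  rw [h1, fourierMultiplierCLM_apply_apply, hΘ, FourierTransform.fourierInv_fourier_eq]
  have h2 : SchwartzMap.smulLeftCLM ℂ m₁ (SchwartzMap.compSubConstCLM ℂ (-η) w) = 0 := by
    ext ξ
    rw [SchwartzMap.smulLeftCLM_apply_apply m₁.hasTemperateGrowth,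
      SchwartzMap.compSubConstCLM_apply, sub_neg_eq_add, hw, SchwartzMap.smulLeftCLM_apply_apply h₃,
      _root_.zero_apply]
    by_cases h3 : m₃ (ξ + η) = 0
    · simp [h3]
    · simp [h ξ η hη h3]
  rw [h2]
  have : (𝓕 (0 : 𝓢(E, ℂ)) : 𝓢(E, ℂ)) = 0 := (fourierCLM ℂ 𝓢(E, ℂ)).map_zero
  rw [this, map_zero]

end Spectrum

/-! ### Convolution estimates -/

section Kernel

/-- Young's inequality `‖K * f‖_{L²} ≤ ‖K‖_{L¹} ‖f‖_{L²}` for nonnegative functions. -/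
theorem lintegral_sq_lintegral_sub_mul_le {K f : R3 → ℝ≥0∞} (hK : Measurable K)
    (hf : Measurable f) :
    ∫⁻ x, (∫⁻ z, K (z - x) * f z) ^ 2 ≤ (∫⁻ y, K y) ^ 2 * ∫⁻ z, f z ^ 2 := by
  -- Cauchy--Schwarz for `K (z - x) * f z = K (z - x) ^ (1/2) * (K (z - x) * f z ^ 2) ^ (1/2)`.
  have h1 : ∀ x, (∫⁻ z, K (z - x) * f z) ^ 2 ≤ (∫⁻ y, K y) * ∫⁻ z, K (z - x) * f z ^ 2 := by
    intro x
    have hKx : Measurable fun z => K (z - x) := hK.comp (measurable_id.sub_const x)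
    have h := ENNReal.lintegral_mul_norm_pow_le (μ := (volume : Measure R3))
      (f := fun z => K (z - x)) (g := fun z => K (z - x) * f z ^ 2) hKx.aemeasurable
      (hKx.mul (hf.pow_const 2)).aemeasurable (p := 1 / 2) (q := 1 / 2) (by norm_num) (by norm_num)
      (by norm_num)
    have e1 : ∀ z, K (z - x) ^ (1 / 2 : ℝ) * (K (z - x) * f z ^ 2) ^ (1 / 2 : ℝ) =
        K (z - x) * f z := by
      intro z
      rw [ENNReal.mul_rpow_of_nonneg _ _ (by norm_num), ← mul_assoc,
        ← ENNReal.rpow_add_of_nonneg _ _ (by norm_num) (by norm_num), ← ENNReal.rpow_natCast,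
        ← ENNReal.rpow_mul]
      norm_num
    simp_rw [e1] at h
    rw [lintegral_sub_right_eq_self (fun y => K y) x] at h
    calc (∫⁻ z, K (z - x) * f z) ^ 2 ≤ ((∫⁻ y, K y) ^ (1 / 2 : ℝ) *
          (∫⁻ z, K (z - x) * f z ^ 2) ^ (1 / 2 : ℝ)) ^ 2 := by gcongr
      _ = _ := by
        rw [mul_pow, ← ENNReal.rpow_natCast, ← ENNReal.rpow_natCast, ← ENNReal.rpow_mul,
          ← ENNReal.rpow_mul]
        norm_num
  have hm : Measurable fun p : R3 × R3 => K (p.2 - p.1) * f p.2 ^ 2 :=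
    (hK.comp (measurable_snd.sub measurable_fst)).mul ((hf.comp measurable_snd).pow_const 2)
  calc ∫⁻ x, (∫⁻ z, K (z - x) * f z) ^ 2
      ≤ ∫⁻ x, (∫⁻ y, K y) * ∫⁻ z, K (z - x) * f z ^ 2 := lintegral_mono h1
    _ = (∫⁻ y, K y) * ∫⁻ x, ∫⁻ z, K (z - x) * f z ^ 2 :=
        lintegral_const_mul _ hm.lintegral_prod_right'
    _ = (∫⁻ y, K y) * ∫⁻ z, ∫⁻ x, K (z - x) * f z ^ 2 := by
        rw [lintegral_lintegral_swap hm.aemeasurable]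
    _ = (∫⁻ y, K y) * ∫⁻ z, (∫⁻ y, K y) * f z ^ 2 := by
        congr 1
        refine lintegral_congr fun z => ?_
        have hKz : Measurable fun x => K (z - x) := hK.comp (measurable_id.const_sub z)
        rw [lintegral_mul_const _ hKz, lintegral_sub_left_eq_self (fun y => K y) z]
    _ = _ := by
        rw [lintegral_const_mul _ (hf.pow_const 2), sq, mul_assoc]

theorem eLpNorm_two_le_of_enorm_le_lintegral {K f : R3 → ℝ≥0∞} (hK : Measurable K)
    (hf : Measurable f) {G : R3 → ℂ} (hG : ∀ x, ‖G x‖ₑ ≤ ∫⁻ z, K (z - x) * f z) :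
    eLpNorm G 2 volume ≤ (∫⁻ y, K y) * (∫⁻ z, f z ^ 2) ^ (1 / 2 : ℝ) := by
  rw [eLpNorm_eq_lintegral_rpow_enorm_toReal (by norm_num) (by norm_num)]
  have h : ∫⁻ x, ‖G x‖ₑ ^ (2 : ℝ≥0∞).toReal ≤ (∫⁻ y, K y) ^ 2 * ∫⁻ z, f z ^ 2 := by
    refine le_trans (lintegral_mono fun x => ?_) (lintegral_sq_lintegral_sub_mul_le hK hf)
    simp only [ENNReal.toReal_ofNat, ENNReal.rpow_ofNat]
    gcongr
    exact hG x
  calc _ ≤ ((∫⁻ y, K y) ^ 2 * ∫⁻ z, f z ^ 2) ^ (1 / (2 : ℝ≥0∞).toReal) := by gcongr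
    _ = _ := by
      rw [ENNReal.mul_rpow_of_nonneg _ _ (by norm_num), ← ENNReal.rpow_natCast, ← ENNReal.rpow_mul]
      norm_num

theorem smoothRep_toTemperedDistribution {p : ℝ≥0∞} [Fact (1 ≤ p)] (m : 𝓢(R3, ℂ))
    (F : Lp ℂ p (volume : Measure R3)) (x : R3) :
    smoothRep m (Lp.toTemperedDistribution F) x = ∫ z, 𝓕 m (z - x) * F z := by
  rw [smoothRep, Lp.toTemperedDistribution_apply]
  simp

theorem integrable_schwartz_mul_Lp {p : ℝ≥0∞} [hp : Fact (1 ≤ p)] (ψ : 𝓢(R3, ℂ))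
    (F : Lp ℂ p (volume : Measure R3)) : Integrable fun z => ψ z * F z := by
  have := ENNReal.HolderConjugate.inv_one_sub_inv' hp.out
  have h := (Lp.memLp F).mul (r := 1) (ψ.memLp (1 - p⁻¹)⁻¹ volume)
    (hpqr := (ENNReal.HolderConjugate.symm : ENNReal.HolderConjugate (1 - p⁻¹)⁻¹ p))
  exact memLp_one_iff_integrable.1 h

/-- A Fourier multiplier almost commutes with the multiplication by a Lipschitz function. The kernel
of the commutator is `k(z - x) (B(z) - B(x))` with `k` the Fourier transform of the symbol. -/
theorem lpNorm_two_commutator_le (m : 𝓢(R3, ℂ)) {B : R3 → ℂ} (hB : B.HasTemperateGrowth)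
    {L : ℝ≥0∞} (hL : ∀ x y, ‖B x - B y‖ₑ ≤ L * ‖x - y‖ₑ) {f : Distr} (hf : lpNorm 2 f ≠ ⊤) :
    lpNorm 2 (fourierMultiplierCLM ℂ m (smulLeftCLM ℂ B f) -
      smulLeftCLM ℂ B (fourierMultiplierCLM ℂ m f)) ≤
      L * (∫⁻ y, ‖y‖ₑ * ‖𝓕 m y‖ₑ) * lpNorm 2 f := by
  have hrep := (represents_smoothRep m (smulLeftCLM ℂ B f)).sub ((represents_smoothRep m f).mul hB)
  obtain ⟨F, rfl⟩ := exists_of_lpNorm_ne_top hf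
  refine (lpNorm_le_eLpNorm hrep).trans ?_
  have hFm : Measurable F := (Lp.stronglyMeasurable F).measurable
  have hkm : Measurable fun y => ‖𝓕 m y‖ₑ := ((𝓕 m).continuous.enorm).measurable
  have hyk : Measurable fun y : R3 => ‖y‖ₑ * ‖𝓕 m y‖ₑ := measurable_enorm.mul hkm
  have hK : Measurable fun y : R3 => L * (‖y‖ₑ * ‖𝓕 m y‖ₑ) := hyk.const_mul L
  refine (eLpNorm_two_le_of_enorm_le_lintegral hK hFm.enorm (fun x => ?_)).trans ?_
  · have e : (smoothRep m (smulLeftCLM ℂ B (Lp.toTemperedDistribution F)) -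
        B * smoothRep m (Lp.toTemperedDistribution F)) x =
        ∫ z, 𝓕 m (z - x) * (B z - B x) * F z := by
      rw [Pi.sub_apply, Pi.mul_apply, smoothRep_toTemperedDistribution, smoothRep,
        smulLeftCLM_apply_apply, Lp.toTemperedDistribution_apply, ← integral_const_mul,
        ← integral_sub]
      · congr 1
        ext z
        rw [SchwartzMap.smulLeftCLM_apply_apply hB, SchwartzMap.compSubConstCLM_apply]
        simp only [smul_eq_mul]
        ring
      · exact integrable_schwartz_mul_Lp _ F
      · exact (integrable_schwartz_mul_Lp (SchwartzMap.compSubConstCLM ℂ x (𝓕 m)) F).const_mul _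
    rw [e]
    refine (enorm_integral_le_lintegral_enorm _).trans (lintegral_mono fun z => ?_)
    rw [enorm_mul, enorm_mul]
    gcongr ?_ * _
    calc ‖𝓕 m (z - x)‖ₑ * ‖B z - B x‖ₑ ≤ ‖𝓕 m (z - x)‖ₑ * (L * ‖z - x‖ₑ) := by
          gcongr
          exact hL z x
      _ = _ := by ring
  · rw [lintegral_const_mul _ hyk, lpNorm_toTemperedDistribution,
      Lp.enorm_def, eLpNorm_eq_lintegral_rpow_enorm_toReal (by norm_num) (by norm_num)]
    simp

theorem lintegral_enorm_sub_translate_le (k : 𝓢(R3, ℂ)) (v : R3) :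
    ∫⁻ w, ‖k (w + v) - k w‖ₑ ≤ ‖v‖ₑ * ∫⁻ w, ‖fderiv ℝ k w‖ₑ := by
  have hfc : Continuous (fderiv ℝ k) := (k.smooth 1).continuous_fderiv (by norm_num)
  have h1 : ∀ w, ‖k (w + v) - k w‖ₑ ≤
      ∫⁻ t in Set.Icc (0 : ℝ) 1, ‖fderiv ℝ k (w + t • v)‖ₑ * ‖v‖ₑ := by
    intro w
    have hd : ∀ t ∈ Set.uIcc (0 : ℝ) 1,
        HasDerivAt (fun t : ℝ => k (w + t • v)) (fderiv ℝ k (w + t • v) v) t := by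
      intro t _
      have h2 : HasDerivAt (fun t : ℝ => w + t • v) v t := by
        simpa using ((hasDerivAt_id t).smul_const v).const_add w
      exact (k.hasFDerivAt (w + t • v)).comp_hasDerivAt t h2
    have hc : Continuous fun t : ℝ => fderiv ℝ k (w + t • v) v := by fun_prop
    have h3 := intervalIntegral.integral_eq_sub_of_hasDerivAt hd (hc.intervalIntegrable 0 1)
    simp only [one_smul, zero_smul, add_zero] at h3
    rw [← h3, intervalIntegral.integral_of_le zero_le_one, ← integral_Icc_eq_integral_Ioc]
    refine (enorm_integral_le_lintegral_enorm _).trans (lintegral_mono fun t => ?_)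
    exact (fderiv ℝ k (w + t • v)).le_opENorm v
  have hm : Measurable fun p : R3 × ℝ => ‖fderiv ℝ k (p.1 + p.2 • v)‖ₑ * ‖v‖ₑ := by
    have : Continuous fun p : R3 × ℝ => ‖fderiv ℝ k (p.1 + p.2 • v)‖ₑ :=
      (hfc.comp (by fun_prop)).enorm
    exact this.measurable.mul_const _
  calc ∫⁻ w, ‖k (w + v) - k w‖ₑ
      ≤ ∫⁻ w, ∫⁻ t in Set.Icc (0 : ℝ) 1, ‖fderiv ℝ k (w + t • v)‖ₑ * ‖v‖ₑ := lintegral_mono h1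
    _ = ∫⁻ t in Set.Icc (0 : ℝ) 1, ∫⁻ w, ‖fderiv ℝ k (w + t • v)‖ₑ * ‖v‖ₑ :=
        lintegral_lintegral_swap hm.aemeasurable
    _ = ∫⁻ t in Set.Icc (0 : ℝ) 1, ‖v‖ₑ * ∫⁻ w, ‖fderiv ℝ k w‖ₑ := by
        refine lintegral_congr fun t => ?_
        have hft : Continuous fun w => ‖fderiv ℝ k (w + t • v)‖ₑ :=
          (hfc.comp (by fun_prop)).enorm
        rw [lintegral_mul_const _ hft.measurable, mul_comm,
          lintegral_add_right_eq_self (fun w => ‖fderiv ℝ k w‖ₑ) (t • v)]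
    _ = _ := by simp

/-- Bernstein: the smooth representative of `m(D) f`, for `f` bounded, is Lipschitz. -/
theorem enorm_smoothRep_sub_le (m : 𝓢(R3, ℂ)) {f : Distr} (hf : lpNorm ⊤ f ≠ ⊤) (x y : R3) :
    ‖smoothRep m f x - smoothRep m f y‖ₑ ≤
      lpNorm ⊤ f * (∫⁻ w, ‖fderiv ℝ (𝓕 m : 𝓢(R3, ℂ)) w‖ₑ) * ‖x - y‖ₑ := by
  obtain ⟨F, rfl⟩ := exists_of_lpNorm_ne_top hf
  rw [smoothRep_toTemperedDistribution, smoothRep_toTemperedDistribution, ← integral_sub]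
  rotate_left
  · exact integrable_schwartz_mul_Lp (SchwartzMap.compSubConstCLM ℂ x (𝓕 m)) F
  · exact integrable_schwartz_mul_Lp (SchwartzMap.compSubConstCLM ℂ y (𝓕 m)) F
  set k : 𝓢(R3, ℂ) := 𝓕 m
  refine (enorm_integral_le_lintegral_enorm _).trans ?_
  rw [lpNorm_toTemperedDistribution]
  have hF : ∀ᵐ z, ‖F z‖ₑ ≤ ‖F‖ₑ := by
    rw [Lp.enorm_def, eLpNorm_exponent_top]
    exact ae_le_eLpNormEssSup
  calc ∫⁻ z, ‖k (z - x) * F z - k (z - y) * F z‖ₑ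
      ≤ ∫⁻ z, ‖F‖ₑ * ‖k (z - x) - k (z - y)‖ₑ := by
        refine lintegral_mono_ae ?_
        filter_upwards [hF] with z hz
        rw [← sub_mul, enorm_mul, mul_comm]
        gcongr
    _ = ‖F‖ₑ * ∫⁻ z, ‖k (z - x) - k (z - y)‖ₑ := by
        refine lintegral_const_mul _ ?_
        have : Continuous fun z => ‖k (z - x) - k (z - y)‖ₑ := by
          have := k.continuous
          fun_prop
        exact this.measurable
    _ = ‖F‖ₑ * ∫⁻ w, ‖k (w + (y - x)) - k w‖ₑ := by
        rw [← lintegral_sub_right_eq_self (fun w => ‖k (w + (y - x)) - k w‖ₑ) y]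
        simp only [sub_add_sub_cancel]
    _ ≤ ‖F‖ₑ * (‖y - x‖ₑ * ∫⁻ w, ‖fderiv ℝ k w‖ₑ) := by
        gcongr
        exact lintegral_enorm_sub_translate_le k (y - x)
    _ = _ := by
        rw [← enorm_neg (y - x), neg_sub]
        ring

end Kernel

/-! ### Dilations -/

section Dilation

theorem lintegral_comp_smul {c : ℝ} (hc : 0 < c) (g : R3 → ℝ≥0∞) :
    ∫⁻ x, g (c • x) = ENNReal.ofReal (c ^ 3)⁻¹ * ∫⁻ x, g x := by
  have h1 := Measure.map_addHaar_smul (volume : Measure R3) hc.ne'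
  have h2 : MeasurableEmbedding fun x : R3 => c • x :=
    (Homeomorph.smulOfNeZero c hc.ne').measurableEmbedding
  have h3 := h2.lintegral_map (μ := volume) g
  have h4 : Measure.map (fun x : R3 => c • x) volume = ENNReal.ofReal (c ^ 3)⁻¹ • volume := by
    have : (fun x : R3 => c • x) = (c • ·) := rfl
    rw [this, h1]
    simp [abs_of_pos hc]
  rw [← h3, h4, lintegral_smul_measure, smul_eq_mul]

theorem fourier_dilation {c : ℝ} (hc : 0 < c) {u w : 𝓢(R3, ℂ)} (h : ∀ ξ, w ξ = u (c • ξ)) (y : R3) :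
    𝓕 w y = (c ^ 3)⁻¹ • 𝓕 u (c⁻¹ • y) := by
  rw [SchwartzMap.fourier_coe, SchwartzMap.fourier_coe, Real.fourier_eq, Real.fourier_eq]
  have h1 := Measure.integral_comp_smul (volume : Measure R3)
    (fun ξ => Real.fourierChar (-inner ℝ ξ (c⁻¹ • y)) • u ξ) c
  have h2 : |(c ^ Module.finrank ℝ R3)⁻¹| = (c ^ 3)⁻¹ := by
    rw [abs_of_pos (by positivity)]
    simp
  rw [h2] at h1
  rw [← h1]
  congr 1
  ext ξ
  rw [h, inner_smul_left, inner_smul_right]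
  simp [hc.ne']

theorem lintegral_enorm_mul_fourier_dilation {c : ℝ} (hc : 0 < c) {u w : 𝓢(R3, ℂ)}
    (h : ∀ ξ, w ξ = u (c • ξ)) :
    ∫⁻ y, ‖y‖ₑ * ‖𝓕 w y‖ₑ = ENNReal.ofReal c * ∫⁻ y, ‖y‖ₑ * ‖𝓕 u y‖ₑ := by
  have h1 : ∀ y : R3, ‖y‖ₑ * ‖𝓕 w y‖ₑ =
      (ENNReal.ofReal c * ENNReal.ofReal (c ^ 3)⁻¹) * (‖c⁻¹ • y‖ₑ * ‖𝓕 u (c⁻¹ • y)‖ₑ) := by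
    intro y
    rw [fourier_dilation hc h, enorm_smul, enorm_smul, Real.enorm_of_nonneg (by positivity),
      Real.enorm_of_nonneg (by positivity)]
    have : ENNReal.ofReal c * ENNReal.ofReal c⁻¹ = 1 := by
      rw [← ENNReal.ofReal_mul hc.le, mul_inv_cancel₀ hc.ne', ENNReal.ofReal_one]
    calc _ = 1 * (‖y‖ₑ * (ENNReal.ofReal (c ^ 3)⁻¹ * ‖𝓕 u (c⁻¹ • y)‖ₑ)) := by rw [one_mul]
      _ = _ := by rw [← this]; ring
  simp_rw [h1]
  rw [lintegral_const_mul, lintegral_comp_smul (inv_pos.2 hc) (fun y => ‖y‖ₑ * ‖𝓕 u y‖ₑ),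
    ← mul_assoc, mul_assoc (ENNReal.ofReal c), ← ENNReal.ofReal_mul (by positivity)]
  · rw [inv_pow, inv_inv, inv_mul_cancel₀ (by positivity), ENNReal.ofReal_one, mul_one]
  · have h2 : Continuous fun y : R3 => ‖(𝓕 u : 𝓢(R3, ℂ)) (c⁻¹ • y)‖ₑ :=
      ((𝓕 u : 𝓢(R3, ℂ)).continuous.comp (by fun_prop)).enorm
    have h3 : Continuous fun y : R3 => ‖c⁻¹ • y‖ₑ := by fun_prop
    exact h3.measurable.mul h2.measurable

theorem lintegral_enorm_fderiv_fourier_dilation {c : ℝ} (hc : 0 < c) {u w : 𝓢(R3, ℂ)}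
    (h : ∀ ξ, w ξ = u (c • ξ)) :
    ∫⁻ y, ‖fderiv ℝ (𝓕 w : 𝓢(R3, ℂ)) y‖ₑ =
      ENNReal.ofReal c⁻¹ * ∫⁻ y, ‖fderiv ℝ (𝓕 u : 𝓢(R3, ℂ)) y‖ₑ := by
  have hfun : (⇑(𝓕 w : 𝓢(R3, ℂ))) = fun y => (c ^ 3)⁻¹ • (𝓕 u : 𝓢(R3, ℂ)) (c⁻¹ • y) := by
    ext y; exact fourier_dilation hc h y
  have h1 : ∀ y : R3, ‖fderiv ℝ (𝓕 w : 𝓢(R3, ℂ)) y‖ₑ =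
      (ENNReal.ofReal (c ^ 3)⁻¹ * ENNReal.ofReal c⁻¹) *
        ‖fderiv ℝ (𝓕 u : 𝓢(R3, ℂ)) (c⁻¹ • y)‖ₑ := by
    intro y
    have h2 : HasFDerivAt (fun y : R3 => (c ^ 3)⁻¹ • (𝓕 u : 𝓢(R3, ℂ)) (c⁻¹ • y))
        ((c ^ 3)⁻¹ • (fderiv ℝ (𝓕 u : 𝓢(R3, ℂ)) (c⁻¹ • y)).comp
          (c⁻¹ • ContinuousLinearMap.id ℝ R3)) y :=
      (((𝓕 u : 𝓢(R3, ℂ)).hasFDerivAt (c⁻¹ • y)).comp y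
        ((hasFDerivAt_id y).fun_const_smul c⁻¹)).fun_const_smul _
    rw [hfun, h2.fderiv, ContinuousLinearMap.comp_smul, ContinuousLinearMap.comp_id, enorm_smul,
      enorm_smul, Real.enorm_of_nonneg (by positivity), Real.enorm_of_nonneg (by positivity),
      mul_assoc]
  simp_rw [h1]
  have hfc : Continuous (fderiv ℝ (𝓕 u : 𝓢(R3, ℂ))) :=
    ((𝓕 u : 𝓢(R3, ℂ)).smooth 1).continuous_fderiv (by norm_num)
  have hft : Continuous fun y => ‖fderiv ℝ (𝓕 u : 𝓢(R3, ℂ)) (c⁻¹ • y)‖ₑ :=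
    (hfc.comp (by fun_prop)).enorm
  rw [lintegral_const_mul _ hft.measurable,
    lintegral_comp_smul (inv_pos.2 hc) (fun y => ‖fderiv ℝ (𝓕 u : 𝓢(R3, ℂ)) y‖ₑ),
    ← mul_assoc, mul_comm (ENNReal.ofReal (c ^ 3)⁻¹), mul_assoc (ENNReal.ofReal c⁻¹),
    ← ENNReal.ofReal_mul (by positivity)]
  rw [inv_pow, inv_inv, inv_mul_cancel₀ (by positivity), ENNReal.ofReal_one, mul_one]

theorem lintegral_enorm_mul_schwartz_ne_top (u : 𝓢(R3, ℂ)) : ∫⁻ y, ‖y‖ₑ * ‖u y‖ₑ ≠ ⊤ := by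
  have h := (u.integrable_pow_mul volume 1).hasFiniteIntegral
  rw [hasFiniteIntegral_iff_enorm] at h
  simpa using h.ne

theorem lintegral_enorm_fderiv_schwartz_ne_top (u : 𝓢(R3, ℂ)) : ∫⁻ y, ‖fderiv ℝ u y‖ₑ ≠ ⊤ := by
  have h := (SchwartzMap.fderivCLM ℝ R3 ℂ u).integrable (μ := volume) |>.hasFiniteIntegral
  rw [hasFiniteIntegral_iff_enorm] at h
  simpa using h.ne

/-- Low-frequency cut-offs `χ(cD) f` converge to `f` as `c → 0`, if `χ = 1` near the origin. -/
theorem tendsto_fourierMultiplierCLM_dilation {ι : Type*} {l : Filter ι} (χ : 𝓢(R3, ℂ)) {r : ℝ}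
    (hr : 0 < r) (hχ : ∀ ξ, ‖ξ‖ < r → χ ξ = 1) (c : ι → ℝ) (w : ι → 𝓢(R3, ℂ))
    (hw : ∀ i ξ, w i ξ = χ (c i • ξ)) (hc0 : ∀ i, 0 < c i) (hc1 : ∀ᶠ i in l, c i ≤ 1)
    (hc : Tendsto c l (𝓝 0)) (f : Distr) :
    Tendsto (fun i => fourierMultiplierCLM ℂ (w i) f) l (𝓝 f) := by
  rw [PointwiseConvergenceCLM.tendsto_iff_forall_tendsto]
  intro ψ
  simp_rw [fourierMultiplierCLM_apply_apply]
  suffices h : Tendsto (fun i => SchwartzMap.smulLeftCLM ℂ (w i) (𝓕⁻ ψ)) l (𝓝 (𝓕⁻ ψ)) by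
    have h1 := ((fourierCLM ℂ 𝓢(R3, ℂ)).continuous.tendsto _).comp h
    have h2 := ((map_continuous f).tendsto _).comp h1
    simpa [Function.comp_def] using h2
  set u : 𝓢(R3, ℂ) := 𝓕⁻ ψ
  rw [(schwartz_withSeminorms ℝ R3 ℂ).tendsto_nhds]
  rintro ⟨m, n⟩ ε hε
  -- the derivatives of `1 - χ`, of order at most `n`, are bounded by `A`
  set A : ℝ := 1 + ∑ i ∈ Finset.range (n + 1), SchwartzMap.seminorm ℝ 0 i χ with hA
  have hA0 : 0 ≤ A := by positivity
  set C : ℝ := ∑ i ∈ Finset.range (n + 1),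
    (n.choose i : ℝ) * A * SchwartzMap.seminorm ℝ (m + 1) (n - i) u with hC
  have hC0 : 0 ≤ C := by positivity
  have key : ∀ i, c i ≤ 1 → SchwartzMap.seminorm ℝ m n (SchwartzMap.smulLeftCLM ℂ (w i) u - u) ≤
      (c i / r) * C := by
    intro j hcj
    have hcj0 := hc0 j
    apply SchwartzMap.seminorm_le_bound _ _ _ _ (by positivity)
    intro x
    set g : R3 → ℂ := fun ξ => w j ξ - 1 with hg
    have hgs : ContDiff ℝ ∞ g := ((w j).smooth ⊤).sub contDiff_const
    have e1 : (⇑(SchwartzMap.smulLeftCLM ℂ (w j) u - u)) = fun ξ => g ξ * u ξ := by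
      ext ξ
      simp [hg, SchwartzMap.smulLeftCLM_apply_apply (w j).hasTemperateGrowth, sub_mul]
    rw [e1]
    -- The difference of the symbols vanishes near `x` unless `|x| ≥ r / c_j`, and there one power
    -- of `|x|` can be traded for a factor `c_j / r`.
    by_cases hx : ‖x‖ < r / c j
    · have hev : (fun ξ => g ξ * u ξ) =ᶠ[𝓝 x] fun _ => 0 := by
        have : ∀ᶠ ξ in 𝓝 x, ‖ξ‖ < r / c j := continuous_norm.tendsto x |>.eventually_lt_const hx
        filter_upwards [this] with ξ hξ
        have h1 : ‖c j • ξ‖ < r := by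
          rw [norm_smul, Real.norm_of_nonneg hcj0.le]
          rwa [lt_div_iff₀' hcj0] at hξ
        simp [hg, hw, hχ _ h1]
      rw [(hev.iteratedFDeriv ℝ n).eq_of_nhds]
      have : iteratedFDeriv ℝ n (fun _ : R3 => (0 : ℂ)) x = 0 := by
        simp
      rw [this, norm_zero, mul_zero]
      positivity
    · have hx' : 1 ≤ (c j / r) * ‖x‖ := by
        rw [not_lt, div_le_iff₀ hcj0] at hx
        rw [div_mul_eq_mul_div, le_div_iff₀ hr]
        linarith
      have hD : ∀ i ≤ n, ‖iteratedFDeriv ℝ i g x‖ ≤ A := by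
        intro i hi
        have hle : SchwartzMap.seminorm ℝ 0 i χ ≤
            ∑ i ∈ Finset.range (n + 1), SchwartzMap.seminorm ℝ 0 i χ :=
          Finset.single_le_sum (f := fun i => SchwartzMap.seminorm ℝ 0 i χ)
            (fun _ _ => apply_nonneg _ _) (Finset.mem_range.2 (by omega))
        have hwf : (⇑(w j)) = fun ξ => χ (c j • ξ) := funext (hw j)
        rcases Nat.eq_zero_or_pos i with rfl | hpos
        · rw [norm_iteratedFDeriv_zero]
          refine (norm_sub_le _ _).trans ?_
          rw [norm_one, hw, add_comm]
          have := SchwartzMap.norm_le_seminorm ℝ χ (c j • x)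
          linarith
        · have e2 : iteratedFDeriv ℝ i g x = iteratedFDeriv ℝ i (w j) x := by
            have : g = ⇑(w j) - fun _ => (1 : ℂ) := rfl
            rw [this, iteratedFDeriv_sub_apply ((w j).smooth i).contDiffAt contDiffAt_const,
              iteratedFDeriv_const_of_ne hpos.ne']
            simp
          rw [e2, hwf, iteratedFDeriv_comp_const_smul _ (χ.smooth i), norm_smul, norm_pow,
            Real.norm_of_nonneg hcj0.le]
          have h1 := SchwartzMap.norm_iteratedFDeriv_le_seminorm ℝ χ i (c j • x)
          have h2 : c j ^ i ≤ 1 := pow_le_one₀ hcj0.le hcj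
          calc _ ≤ 1 * SchwartzMap.seminorm ℝ 0 i χ := by gcongr
            _ ≤ A := by linarith
      calc ‖x‖ ^ m * ‖iteratedFDeriv ℝ n (fun ξ => g ξ * u ξ) x‖
          ≤ ((c j / r) * ‖x‖) * ‖x‖ ^ m * ∑ i ∈ Finset.range (n + 1),
            (n.choose i : ℝ) * ‖iteratedFDeriv ℝ i g x‖ * ‖iteratedFDeriv ℝ (n - i) u x‖ := by
            have h1 := norm_iteratedFDeriv_mul_le (n := n) hgs (u.smooth ⊤) x
              (by exact_mod_cast le_top)
            have h2 : ‖x‖ ^ m ≤ ((c j / r) * ‖x‖) * ‖x‖ ^ m :=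
              le_mul_of_one_le_left (by positivity) hx'
            gcongr
        _ = (c j / r) * ∑ i ∈ Finset.range (n + 1), (n.choose i : ℝ) * ‖iteratedFDeriv ℝ i g x‖ *
            (‖x‖ ^ (m + 1) * ‖iteratedFDeriv ℝ (n - i) u x‖) := by
            rw [mul_assoc, mul_assoc, Finset.mul_sum, Finset.mul_sum]
            congr 1
            refine Finset.sum_congr rfl fun i _ => ?_
            ring
        _ ≤ (c j / r) * C := by
            refine mul_le_mul_of_nonneg_left (Finset.sum_le_sum fun i hi => ?_) (by positivity)
            refine mul_le_mul (mul_le_mul_of_nonneg_left (hD i ?_) (by positivity))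
              (SchwartzMap.le_seminorm ℝ (m + 1) (n - i) u x) (by positivity) (by positivity)
            have := Finset.mem_range.1 hi
            omega
  have hlim : Tendsto (fun i => (c i / r) * C) l (𝓝 0) := by
    simpa using (hc.div_const r).mul_const C
  filter_upwards [hlim.eventually_lt_const hε, hc1] with i h1 h2
  exact (key i h2).trans_lt h1

end Dilation

/-! ### Dyadic blocks -/

theorem two_zpow_mul_pow_le {j k : ℤ} (n : ℕ) (h : j + n ≤ k) : (2 : ℝ) ^ j * 2 ^ n ≤ 2 ^ k := by
  rw [← zpow_natCast, ← zpow_add₀ (by norm_num)]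
  exact zpow_le_zpow_right₀ (by norm_num) h

theorem norm_two_zpow_neg_smul (j : ℤ) (ξ : R3) : ‖(2 : ℝ) ^ (-j) • ξ‖ = ‖ξ‖ / 2 ^ j := by
  rw [norm_smul, Real.norm_of_nonneg (by positivity), zpow_neg, inv_mul_eq_div]

theorem fourierMultiplierCLM_sub {m₁ m₂ : R3 → ℂ} (h₁ : m₁.HasTemperateGrowth)
    (h₂ : m₂.HasTemperateGrowth) :
    fourierMultiplierCLM ℂ (m₁ - m₂) = fourierMultiplierCLM ℂ m₁ - fourierMultiplierCLM ℂ m₂ := by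
  ext f ψ
  simp only [fourierMultiplierCLM_apply_apply, _root_.sub_apply]
  rw [← map_sub f]
  congr 1
  refine Eq.trans ?_ (map_sub (fourierCLM ℂ 𝓢(R3, ℂ)) _ _)
  refine congrArg (fourierCLM ℂ 𝓢(R3, ℂ)) ?_
  ext ξ
  rw [sub_apply, SchwartzMap.smulLeftCLM_apply_apply (h₁.sub h₂),
    SchwartzMap.smulLeftCLM_apply_apply h₁, SchwartzMap.smulLeftCLM_apply_apply h₂, Pi.sub_apply,
    sub_smul]

namespace DyadicPair

variable (D : DyadicPair)

theorem le_norm_of_φ_ne_zero {j : ℤ} {ξ : R3} (h : D.φ ((2 : ℝ) ^ (-j) • ξ) ≠ 0) :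
    3 / 4 * 2 ^ j ≤ ‖ξ‖ ∧ ‖ξ‖ ≤ 8 / 3 * 2 ^ j := by
  have h1 := D.φ_supp h
  rw [Set.mem_ofPred_eq, norm_two_zpow_neg_smul] at h1
  have h2 : (0 : ℝ) < 2 ^ j := by positivity
  rwa [le_div_iff₀ h2, div_le_iff₀ h2] at h1

theorem norm_le_of_χ_ne_zero {j : ℤ} {ξ : R3} (h : D.χ ((2 : ℝ) ^ (-j) • ξ) ≠ 0) :
    ‖ξ‖ ≤ 4 / 3 * 2 ^ j := by
  have h1 := D.χ_supp h
  rw [Set.mem_ofPred_eq, norm_two_zpow_neg_smul] at h1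
  have h2 : (0 : ℝ) < 2 ^ j := by positivity
  rwa [div_le_iff₀ h2] at h1

theorem χ_eq_one {ξ : R3} (h : ‖ξ‖ < 3 / 4) : D.χ ξ = 1 := by
  have h1 : ∀ q : ℕ, D.φ ((2 : ℝ) ^ (-(q : ℤ)) • ξ) = 0 := by
    intro q
    by_contra hne
    have h2 := (D.le_norm_of_φ_ne_zero hne).1
    have h3 : (1 : ℝ) ≤ 2 ^ (q : ℤ) := one_le_zpow₀ (by norm_num) (by positivity)
    linarith
  have h2 := (D.sum_nat ξ).unique (by simpa only [h1] using hasSum_zero)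
  linarith

/-- Comparing the partition of unity at `ξ` and at `ξ / 2` gives the telescoping identity between
`χ` and `φ`. -/
theorem χ_half_sub (ξ : R3) : D.χ ((2 : ℝ)⁻¹ • ξ) - D.χ ξ = D.φ ξ := by
  have h1 := (hasSum_nat_add_iff' 1).2 (D.sum_nat ξ)
  have h2 := D.sum_nat ((2 : ℝ)⁻¹ • ξ)
  have h3 : ∀ q : ℕ, D.φ ((2 : ℝ) ^ (-((q + 1 : ℕ) : ℤ)) • ξ) =
      D.φ ((2 : ℝ) ^ (-(q : ℤ)) • (2 : ℝ)⁻¹ • ξ) := by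
    intro q
    rw [smul_smul, ← zpow_neg_one, ← zpow_add₀ (by norm_num)]
    congr 3
    push_cast
    ring
  simp_rw [h3] at h1
  have h4 := h1.unique h2
  simp at h4
  linarith

/-- The symbol `φ(2^{-j} ξ)` of `Δ_j` as a Schwartz function. -/
def blockSymbol (j : ℤ) : 𝓢(R3, ℂ) :=
  HasCompactSupport.toSchwartzMap (f := fun ξ : R3 => ((D.φ ((2 : ℝ) ^ (-j) • ξ) : ℝ) : ℂ))
    (HasCompactSupport.of_support_subset_isCompact (isCompact_closedBall 0 (8 / 3 * 2 ^ j))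
      fun ξ hξ => by
        rw [mem_closedBall_zero_iff]
        refine (D.le_norm_of_φ_ne_zero fun h => hξ ?_).2
        simp only [h, Complex.ofReal_zero])
    (Complex.ofRealCLM.contDiff.comp (D.φ_smooth.comp (contDiff_const_smul _)))

/-- The symbol `χ(2^{-j} ξ)` of `S_j` as a Schwartz function. -/
def lowSymbol (j : ℤ) : 𝓢(R3, ℂ) :=
  HasCompactSupport.toSchwartzMap (f := fun ξ : R3 => ((D.χ ((2 : ℝ) ^ (-j) • ξ) : ℝ) : ℂ))
    (HasCompactSupport.of_support_subset_isCompact (isCompact_closedBall 0 (4 / 3 * 2 ^ j))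
      fun ξ hξ => by
        rw [mem_closedBall_zero_iff]
        refine D.norm_le_of_χ_ne_zero fun h => hξ ?_
        simp only [h, Complex.ofReal_zero])
    (Complex.ofRealCLM.contDiff.comp (D.χ_smooth.comp (contDiff_const_smul _)))

theorem blockSymbol_apply (j : ℤ) (ξ : R3) :
    D.blockSymbol j ξ = ((D.φ ((2 : ℝ) ^ (-j) • ξ) : ℝ) : ℂ) := rfl

theorem lowSymbol_apply (j : ℤ) (ξ : R3) :
    D.lowSymbol j ξ = ((D.χ ((2 : ℝ) ^ (-j) • ξ) : ℝ) : ℂ) := rfl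

theorem block_eq (j : ℤ) (f : Distr) :
    D.block j f = fourierMultiplierCLM ℂ (D.blockSymbol j) f := rfl

theorem lowFreq_eq (j : ℤ) (f : Distr) :
    D.lowFreq j f = fourierMultiplierCLM ℂ (D.lowSymbol j) f := rfl

theorem norm_of_blockSymbol_ne_zero {j : ℤ} {ξ : R3} (h : D.blockSymbol j ξ ≠ 0) :
    3 / 4 * 2 ^ j ≤ ‖ξ‖ ∧ ‖ξ‖ ≤ 8 / 3 * 2 ^ j :=
  D.le_norm_of_φ_ne_zero fun h' => h (by rw [blockSymbol_apply, h', Complex.ofReal_zero])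

theorem norm_le_of_lowSymbol_ne_zero {j : ℤ} {ξ : R3} (h : D.lowSymbol j ξ ≠ 0) :
    ‖ξ‖ ≤ 4 / 3 * 2 ^ j :=
  D.norm_le_of_χ_ne_zero fun h' => h (by rw [lowSymbol_apply, h', Complex.ofReal_zero])

theorem lowSymbol_eq_one {j : ℤ} {ξ : R3} (h : ‖ξ‖ < 3 / 4 * 2 ^ j) : D.lowSymbol j ξ = 1 := by
  rw [lowSymbol_apply, D.χ_eq_one, Complex.ofReal_one]
  rwa [norm_two_zpow_neg_smul, div_lt_iff₀ (by positivity)]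

theorem lowSymbol_add_one_sub (j : ℤ) : D.lowSymbol (j + 1) - D.lowSymbol j = D.blockSymbol j := by
  ext ξ
  rw [sub_apply, lowSymbol_apply, lowSymbol_apply, blockSymbol_apply, ← D.χ_half_sub,
    smul_smul, ← Complex.ofReal_sub]
  congr 4
  rw [← zpow_neg_one, ← zpow_add₀ (by norm_num)]
  congr 1
  ring

theorem enorm_blockSymbol_le (j : ℤ) (ξ : R3) : ‖D.blockSymbol j ξ‖ₑ ≤ 1 := by
  rw [blockSymbol_apply, ← ofReal_norm, Complex.norm_real, Real.norm_of_nonneg (D.φ_mem _).1]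
  simpa using (D.φ_mem _).2

theorem lowFreq_add_one_sub (j : ℤ) (f : Distr) :
    D.lowFreq (j + 1) f - D.lowFreq j f = D.block j f := by
  rw [block_eq, lowFreq_eq, lowFreq_eq, ← sub_apply, ← fourierMultiplierCLM_sub
    (SchwartzMap.hasTemperateGrowth _) (SchwartzMap.hasTemperateGrowth _), ← lowSymbol_add_one_sub]
  rfl

theorem sum_block_Ico {k n : ℤ} (h : k ≤ n) (f : Distr) :
    ∑ i ∈ Finset.Ico k n, D.block i f = D.lowFreq n f - D.lowFreq k f := by
  induction n, h using Int.leInduction with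
  | base => simp
  | succ n h ih =>
    rw [← Finset.insert_Ico_right_eq_Ico_add_one h, Finset.sum_insert (by simp), ih,
      ← D.lowFreq_add_one_sub]
    abel

theorem sum_block_range (n : ℕ) (f : Distr) :
    ∑ i ∈ Finset.range n, D.block i f = D.lowFreq n f - D.lowFreq 0 f := by
  induction n with
  | zero => simp
  | succ n ih =>
    rw [Finset.sum_range_succ, ih, ← D.lowFreq_add_one_sub]
    push_cast
    abel

theorem lowFreq_block_eq_self {j m : ℤ} (h : j + 2 ≤ m) (f : Distr) :
    D.lowFreq m (D.block j f) = D.block j f := by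
  rw [lowFreq_eq, block_eq, fourierMultiplierCLM_fourierMultiplierCLM_apply
    (D.blockSymbol j).hasTemperateGrowth (D.lowSymbol m).hasTemperateGrowth]
  congr 2
  ext ξ
  rw [Pi.mul_apply]
  by_cases hξ : D.blockSymbol j ξ = 0
  · simp [hξ]
  · have h1 := D.norm_of_blockSymbol_ne_zero hξ
    have h2 := two_zpow_mul_pow_le 2 (by simpa using h)
    have h3 : (0 : ℝ) < 2 ^ j := by positivity
    rw [D.lowSymbol_eq_one (by linarith), mul_one]

theorem fourierMultiplierCLM_comm (m₁ m₂ : 𝓢(R3, ℂ)) (f : Distr) :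
    fourierMultiplierCLM ℂ m₁ (fourierMultiplierCLM ℂ m₂ f) =
      fourierMultiplierCLM ℂ m₂ (fourierMultiplierCLM ℂ m₁ f) := by
  rw [fourierMultiplierCLM_fourierMultiplierCLM_apply m₂.hasTemperateGrowth m₁.hasTemperateGrowth,
    fourierMultiplierCLM_fourierMultiplierCLM_apply m₁.hasTemperateGrowth m₂.hasTemperateGrowth,
    mul_comm]

theorem block_lowFreq_comm (j m : ℤ) (f : Distr) :
    D.block j (D.lowFreq m f) = D.lowFreq m (D.block j f) := by
  rw [block_eq, lowFreq_eq, lowFreq_eq, block_eq, fourierMultiplierCLM_comm]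

theorem block_block_eq_zero {j k : ℤ} (h : j + 2 ≤ k ∨ k + 2 ≤ j) (f : Distr) :
    D.block j (D.block k f) = 0 := by
  rw [block_eq, block_eq, fourierMultiplierCLM_fourierMultiplierCLM_apply
    (D.blockSymbol k).hasTemperateGrowth (D.blockSymbol j).hasTemperateGrowth]
  have : (⇑(D.blockSymbol k) * ⇑(D.blockSymbol j)) = fun _ => 0 := by
    ext ξ
    rw [Pi.mul_apply]
    by_contra hne
    rw [mul_eq_zero, not_or] at hne
    have h1 := D.norm_of_blockSymbol_ne_zero hne.1
    have h2 := D.norm_of_blockSymbol_ne_zero hne.2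
    have h3 : (0 : ℝ) < 2 ^ j := by positivity
    have h4 : (0 : ℝ) < 2 ^ k := by positivity
    rcases h with h | h
    · have h5 := two_zpow_mul_pow_le 2 (by simpa using h)
      linarith
    · have h5 := two_zpow_mul_pow_le 2 (by simpa using h)
      linarith
  rw [this]
  simp

theorem tendsto_lowFreq (f : Distr) :
    Tendsto (fun n : ℕ => D.lowFreq n f) atTop (𝓝 f) := by
  have h2 : Tendsto (fun n : ℕ => (2 : ℝ) ^ (-(n : ℤ))) atTop (𝓝 0) := by
    simpa [zpow_neg, Function.comp_def] using tendsto_inv_atTop_zero.comp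
      (tendsto_pow_atTop_atTop_of_one_lt (one_lt_two : (1 : ℝ) < 2))
  refine tendsto_fourierMultiplierCLM_dilation (D.lowSymbol 0) (r := 3 / 4) (by norm_num)
    (fun ξ hξ => D.lowSymbol_eq_one (by simpa using hξ)) (fun n : ℕ => (2 : ℝ) ^ (-(n : ℤ)))
    (fun n => D.lowSymbol n) ?_ (fun n => by positivity)
    (h2.eventually_le_const zero_lt_one) h2 f
  intro n ξ
  simp [lowSymbol_apply]

/-- The product of two dyadic blocks; it is computed by the smooth representative of `Δ_l b`. -/
def blockMul (l k : ℤ) (b a : Distr) : Distr :=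
  smulLeftCLM ℂ (smoothRep (D.blockSymbol l) b) (D.block k a)

/-- The spectrum of a product of two blocks lies in the sum of two annuli. -/
theorem block_blockMul_eq_zero {j k l : ℤ} (h : (k + 3 ≤ j ∧ l + 3 ≤ j) ∨ (j + 3 ≤ k ∧ l + 3 ≤ k))
    (b a : Distr) : D.block j (D.blockMul l k b a) = 0 := by
  refine fourierMultiplierCLM_smulLeftCLM_smoothRep_eq_zero (D.blockSymbol l)
    (D.blockSymbol k).hasTemperateGrowth (D.blockSymbol j).hasTemperateGrowth ?_ b a
  intro ξ η h2 h3
  by_contra h1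
  have h1 := D.norm_of_blockSymbol_ne_zero h1
  have h2 := D.norm_of_blockSymbol_ne_zero h2
  have h3 := D.norm_of_blockSymbol_ne_zero h3
  have hj : (0 : ℝ) < 2 ^ j := by positivity
  have hk : (0 : ℝ) < 2 ^ k := by positivity
  rcases h with ⟨h, h'⟩ | ⟨h, h'⟩
  · have h5 := two_zpow_mul_pow_le 3 (by simpa using h)
    have h6 := two_zpow_mul_pow_le 3 (by simpa using h')
    have h7 := norm_add_le ξ η
    linarith
  · have h5 := two_zpow_mul_pow_le 3 (by simpa using h)
    have h6 := two_zpow_mul_pow_le 3 (by simpa using h')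
    have h7 : ‖η‖ ≤ ‖ξ + η‖ + ‖ξ‖ := by simpa using norm_sub_le (ξ + η) ξ
    linarith

theorem lowFreq_blockMul_eq_zero {k l : ℤ} (h : l + 3 ≤ k) (b a : Distr) :
    D.lowFreq (k - 3) (D.blockMul l k b a) = 0 := by
  refine fourierMultiplierCLM_smulLeftCLM_smoothRep_eq_zero (D.blockSymbol l)
    (D.blockSymbol k).hasTemperateGrowth (D.lowSymbol (k - 3)).hasTemperateGrowth ?_ b a
  intro ξ η h2 h3
  by_contra h1
  have h1 := D.norm_of_blockSymbol_ne_zero h1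
  have h2 := D.norm_of_blockSymbol_ne_zero h2
  have h3 := D.norm_le_of_lowSymbol_ne_zero h3
  have hk : (0 : ℝ) < 2 ^ k := by positivity
  have h5 := two_zpow_mul_pow_le (j := k - 3) (k := k) 3 (by simp)
  have h6 := two_zpow_mul_pow_le 3 (by simpa using h)
  have h7 : ‖η‖ ≤ ‖ξ + η‖ + ‖ξ‖ := by simpa using norm_sub_le (ξ + η) ξ
  linarith

theorem represents_block (j : ℤ) (f : Distr) :
    Represents (smoothRep (D.blockSymbol j) f) (D.block j f) :=
  represents_smoothRep _ _

theorem represents_lowFreq (j : ℤ) (f : Distr) :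
    Represents (smoothRep (D.lowSymbol j) f) (D.lowFreq j f) :=
  represents_smoothRep _ _

theorem blockMul_eq (l k : ℤ) (b a : Distr) :
    D.blockMul l k b a = smulLeftCLM ℂ (smoothRep (D.blockSymbol k) a) (D.block l b) :=
  smulLeftCLM_comm_of_represents (D.represents_block l b) (D.represents_block k a)

theorem lpNorm_blockMul_le {p : ℝ≥0∞} [Fact (1 ≤ p)] (l k : ℤ) (b a : Distr) :
    lpNorm p (D.blockMul l k b a) ≤ lpNorm ⊤ (D.block l b) * lpNorm p (D.block k a) :=
  lpNorm_smulLeftCLM_le (hasTemperateGrowth_smoothRep _ _)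
    (enorm_le_lpNorm_top (D.represents_block l b)) _

theorem lpNorm_blockMul_le' {p : ℝ≥0∞} [Fact (1 ≤ p)] (l k : ℤ) (b a : Distr) :
    lpNorm p (D.blockMul l k b a) ≤ lpNorm p (D.block l b) * lpNorm ⊤ (D.block k a) := by
  rw [blockMul_eq, mul_comm]
  exact lpNorm_smulLeftCLM_le (hasTemperateGrowth_smoothRep _ _)
    (enorm_le_lpNorm_top (D.represents_block k a)) _

theorem lpNorm_two_block_le (j : ℤ) (f : Distr) : lpNorm 2 (D.block j f) ≤ lpNorm 2 f := by
  rw [block_eq]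
  simpa using lpNorm_two_fourierMultiplierCLM_le (D.blockSymbol j).hasTemperateGrowth
    (D.enorm_blockSymbol_le j) f

/-- The commutator `[Δ_j, Δ_l b] f`, where `Δ_l b` acts through its smooth representative. -/
def blockComm (j l : ℤ) (b f : Distr) : Distr :=
  D.block j (smulLeftCLM ℂ (smoothRep (D.blockSymbol l) b) f) -
    smulLeftCLM ℂ (smoothRep (D.blockSymbol l) b) (D.block j f)

theorem lpNorm_two_blockComm_le_two_mul (j l : ℤ) (b f : Distr) :
    lpNorm 2 (D.blockComm j l b f) ≤ 2 * (lpNorm ⊤ (D.block l b) * lpNorm 2 f) := by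
  have h := fun f => lpNorm_smulLeftCLM_le (p := 2)
    (hasTemperateGrowth_smoothRep (D.blockSymbol l) b)
    (enorm_le_lpNorm_top (D.represents_block l b)) f
  refine (lpNorm_sub_le _ _).trans ?_
  rw [two_mul]
  refine add_le_add ((D.lpNorm_two_block_le _ _).trans (h f)) ((h _).trans ?_)
  gcongr
  exact D.lpNorm_two_block_le _ _

/-- The gain `2^{l - j}` of the commutator: the Lipschitz constant of `Δ_l b` is at most
`C 2^l ‖Δ_l b‖_∞` and the kernel of `Δ_j` has first moment `C 2^{-j}`. -/
theorem exists_lpNorm_two_blockComm_le : ∃ C : ℝ≥0, ∀ (j l : ℤ) (b f : Distr), lpNorm 2 f ≠ ⊤ →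
    lpNorm ⊤ (D.block l b) ≠ ⊤ → lpNorm 2 (D.blockComm j l b f) ≤
      C * ENNReal.ofReal (2 ^ (l - j)) * (lpNorm ⊤ (D.block l b) * lpNorm 2 f) := by
  set I₁ := ∫⁻ y, ‖y‖ₑ * ‖𝓕 (D.blockSymbol 0) y‖ₑ
  set I₂ := ∫⁻ y, ‖fderiv ℝ (𝓕 (D.lowSymbol 2) : 𝓢(R3, ℂ)) y‖ₑ
  have h₁ : I₁ ≠ ⊤ := lintegral_enorm_mul_schwartz_ne_top _
  have h₂ : I₂ ≠ ⊤ := lintegral_enorm_fderiv_schwartz_ne_top _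
  refine ⟨(I₁ * I₂).toNNReal, fun j l b f hf hb => ?_⟩
  rw [ENNReal.coe_toNNReal (ENNReal.mul_ne_top h₁ h₂)]
  set g := smoothRep (D.blockSymbol l) b
  have hrep : Represents g (D.block l b) := D.represents_block l b
  -- The kernel of `S_{l+2}` replaces the one of `Δ_l`: it turns the bound on `Δ_l b`, and not only
  -- one on `b`, into a Lipschitz bound.
  have hg : g = smoothRep (D.lowSymbol (l + 2)) (D.block l b) := by
    have h := D.represents_lowFreq (l + 2) (D.block l b)
    rw [D.lowFreq_block_eq_self le_rfl] at h
    exact hrep.unique h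
  have hL : ∀ x y, ‖g x - g y‖ₑ ≤
      lpNorm ⊤ (D.block l b) * (ENNReal.ofReal (2 ^ l) * I₂) * ‖x - y‖ₑ := by
    intro x y
    rw [hg]
    refine (enorm_smoothRep_sub_le _ hb x y).trans_eq ?_
    rw [lintegral_enorm_fderiv_fourier_dilation (c := 2 ^ (-l)) (u := D.lowSymbol 2)
      (by positivity)]
    · rw [zpow_neg, inv_inv]
    · intro ξ
      rw [lowSymbol_apply, lowSymbol_apply, smul_smul, ← zpow_add₀ (by norm_num)]
      congr 4
      ring
  refine (lpNorm_two_commutator_le (D.blockSymbol j) hrep.hasTemperateGrowth hL hf).trans_eq ?_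
  rw [lintegral_enorm_mul_fourier_dilation (c := 2 ^ (-j)) (u := D.blockSymbol 0) (by positivity)]
  · rw [zpow_sub₀ (by norm_num), div_eq_mul_inv, ← zpow_neg, ENNReal.ofReal_mul (by positivity)]
    ring
  · intro ξ
    rw [blockSymbol_apply, blockSymbol_apply, smul_smul, ← zpow_add₀ (by norm_num)]
    congr 4
    ring

end DyadicPair

/-! ### Geometric sums over the integers -/

theorem two_rpow_ne_zero (x : ℝ) : (2 : ℝ≥0∞) ^ x ≠ 0 := by simp

theorem two_rpow_ne_top (x : ℝ) : (2 : ℝ≥0∞) ^ x ≠ ⊤ := by simp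

theorem two_rpow_add (x y : ℝ) : (2 : ℝ≥0∞) ^ (x + y) = 2 ^ x * 2 ^ y :=
  ENNReal.rpow_add _ _ (by simp) (by simp)

theorem two_rpow_le {x y : ℝ} (h : x ≤ y) : (2 : ℝ≥0∞) ^ x ≤ 2 ^ y :=
  ENNReal.rpow_le_rpow_of_exponent_le (by norm_num) h

theorem exists_tsum_le_two_rpow {θ : ℝ} (hθ : 0 < θ) : ∃ C : ℝ≥0, ∀ m : ℤ,
    ∑' k : ℤ, (if k ≤ m then (2 : ℝ≥0∞) ^ ((k : ℝ) * θ) else 0) ≤ C * 2 ^ ((m : ℝ) * θ) := by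
  have hlt : (2 : ℝ≥0∞) ^ (-θ) < 1 := by
    simpa using ENNReal.rpow_lt_rpow_of_exponent_lt (x := 2) (by norm_num) (by norm_num)
      (neg_lt_zero.2 hθ)
  have hne : (1 - (2 : ℝ≥0∞) ^ (-θ))⁻¹ ≠ ⊤ := ENNReal.inv_ne_top.2 (tsub_pos_of_lt hlt).ne'
  refine ⟨((1 - (2 : ℝ≥0∞) ^ (-θ))⁻¹).toNNReal, fun m => ?_⟩
  rw [ENNReal.coe_toNNReal hne]
  have hinj : Function.Injective fun i : ℕ => m - (i : ℤ) := fun a b h => by simpa using h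
  have hsupp : Function.support (fun k : ℤ => if k ≤ m then (2 : ℝ≥0∞) ^ ((k : ℝ) * θ) else 0) ⊆
      Set.range fun i : ℕ => m - (i : ℤ) := by
    intro k hk
    have hkm : k ≤ m := by
      by_contra h
      simp [h] at hk
    exact ⟨(m - k).toNat, by simp [hkm]⟩
  rw [← hinj.tsum_eq hsupp, ← ENNReal.tsum_geometric, ← ENNReal.tsum_mul_right]
  refine ENNReal.tsum_le_tsum fun i => le_of_eq ?_
  rw [if_pos (by simp), ← ENNReal.rpow_natCast, ← ENNReal.rpow_mul, ← two_rpow_add]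
  congr 1
  push_cast
  ring

theorem exists_tsum_ge_two_rpow {θ : ℝ} (hθ : 0 < θ) : ∃ C : ℝ≥0, ∀ m : ℤ,
    ∑' k : ℤ, (if m ≤ k then (2 : ℝ≥0∞) ^ (-((k : ℝ) * θ)) else 0) ≤ C * 2 ^ (-((m : ℝ) * θ)) := by
  obtain ⟨C, hC⟩ := exists_tsum_le_two_rpow hθ
  refine ⟨C, fun m => ?_⟩
  rw [← (Equiv.neg ℤ).tsum_eq]
  have := hC (-m)
  simp only [Int.cast_neg, neg_mul] at this
  refine le_trans (ENNReal.tsum_le_tsum fun k => ?_) this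
  simp [le_neg]

/-- `∑_l min(1, 2^{l-j}) 2^{-lα} ≤ C 2^{-jα}` for `0 < α < 1`. -/
theorem exists_tsum_min_two_rpow {α : ℝ} (h0 : 0 < α) (h1 : α < 1) : ∃ C : ℝ≥0, ∀ j : ℤ,
    ∑' l : ℤ, min 1 (ENNReal.ofReal (2 ^ (l - j))) * (2 : ℝ≥0∞) ^ (-((l : ℝ) * α)) ≤
      C * 2 ^ (-((j : ℝ) * α)) := by
  obtain ⟨C₁, hC₁⟩ := exists_tsum_le_two_rpow (sub_pos.2 h1)
  obtain ⟨C₂, hC₂⟩ := exists_tsum_ge_two_rpow h0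
  refine ⟨C₁ + C₂, fun j => ?_⟩
  have e : ∀ l : ℤ, ENNReal.ofReal (2 ^ (l - j)) = 2 ^ ((l : ℝ) - j) := by
    intro l
    rw [← Real.rpow_intCast, ENNReal.ofReal_rpow_of_pos (by norm_num) |>.symm]
    simp
  calc ∑' l : ℤ, min 1 (ENNReal.ofReal (2 ^ (l - j))) * (2 : ℝ≥0∞) ^ (-((l : ℝ) * α))
      ≤ ∑' l : ℤ, (2 ^ (-(j : ℝ)) * (if l ≤ j then (2 : ℝ≥0∞) ^ ((l : ℝ) * (1 - α)) else 0) +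
        (if j ≤ l then (2 : ℝ≥0∞) ^ (-((l : ℝ) * α)) else 0)) := by
        refine ENNReal.tsum_le_tsum fun l => ?_
        rcases le_total l j with h | h
        · rw [if_pos h]
          refine le_add_right ?_
          calc _ ≤ ENNReal.ofReal (2 ^ (l - j)) * (2 : ℝ≥0∞) ^ (-((l : ℝ) * α)) := by
                gcongr
                exact min_le_right _ _
            _ = _ := by
                rw [e, ← two_rpow_add, ← two_rpow_add]
                congr 1
                ring
        · rw [if_pos h]
          refine le_add_left ?_
          calc _ ≤ 1 * (2 : ℝ≥0∞) ^ (-((l : ℝ) * α)) := by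
                gcongr
                exact min_le_left _ _
            _ = _ := one_mul _
    _ ≤ 2 ^ (-(j : ℝ)) * (C₁ * 2 ^ ((j : ℝ) * (1 - α))) + C₂ * 2 ^ (-((j : ℝ) * α)) := by
        rw [ENNReal.tsum_add, ENNReal.tsum_mul_left]
        gcongr
        · exact hC₁ j
        · exact hC₂ j
    _ = _ := by
        have : (2 : ℝ≥0∞) ^ (-((j : ℝ) * α)) = 2 ^ (-(j : ℝ)) * 2 ^ ((j : ℝ) * (1 - α)) := by
          rw [← two_rpow_add]
          congr 1
          ring
        rw [this, ENNReal.coe_add]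
        ring

/-! ### Besov norms -/

namespace DyadicPair

variable (D : DyadicPair)

theorem besovNorm_one (s : ℝ) (p : ℝ≥0∞) [Fact (1 ≤ p)] (f : Distr) :
    D.besovNorm s p 1 f = ∑' j : ℤ, (2 : ℝ≥0∞) ^ ((j : ℝ) * s) * lpNorm p (D.block j f) := by
  simp [besovNorm]

theorem lpNorm_block_le_besovNorm_top (s : ℝ) (p : ℝ≥0∞) [Fact (1 ≤ p)] (f : Distr) (j : ℤ) :
    lpNorm p (D.block j f) ≤ 2 ^ (-((j : ℝ) * s)) * D.besovNorm s p ⊤ f := by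
  have h1 : 2 ^ ((j : ℝ) * s) * lpNorm p (D.block j f) ≤ D.besovNorm s p ⊤ f := by
    rw [besovNorm, if_pos rfl]
    exact le_iSup (fun j : ℤ => (2 : ℝ≥0∞) ^ ((j : ℝ) * s) * lpNorm p (D.block j f)) j
  calc lpNorm p (D.block j f) =
        2 ^ (-((j : ℝ) * s)) * (2 ^ ((j : ℝ) * s) * lpNorm p (D.block j f)) := by
        rw [← mul_assoc, ← two_rpow_add]
        simp
    _ ≤ _ := by gcongr

theorem lpNorm_block_ne_top_of_besovNorm_one {s : ℝ} {p : ℝ≥0∞} [Fact (1 ≤ p)] {f : Distr}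
    (h : D.besovNorm s p 1 f ≠ ⊤) (j : ℤ) : lpNorm p (D.block j f) ≠ ⊤ := by
  rw [besovNorm_one] at h
  have h1 := ENNReal.ne_top_of_tsum_ne_top h j
  intro h2
  rw [h2, ENNReal.mul_top (two_rpow_ne_zero _)] at h1
  exact h1 rfl

theorem lpNorm_block_ne_top_of_besovNorm_top {s : ℝ} {p : ℝ≥0∞} [Fact (1 ≤ p)] {f : Distr}
    (h : D.besovNorm s p ⊤ f ≠ ⊤) (j : ℤ) : lpNorm p (D.block j f) ≠ ⊤ :=
  ne_top_of_le_ne_top (ENNReal.mul_ne_top (two_rpow_ne_top _) h)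
    (D.lpNorm_block_le_besovNorm_top s p f j)

theorem MemSh.tendsto_sum_block {f : Distr} (h : D.MemSh f) (n : ℤ) :
    Tendsto (fun K : ℤ => ∑ i ∈ Finset.Ico K n, D.block i f) atBot (𝓝 (D.lowFreq n f)) := by
  have h1 : Tendsto (fun K : ℤ => D.lowFreq n f - D.lowFreq K f) atBot (𝓝 (D.lowFreq n f)) := by
    simpa using tendsto_const_nhds.sub h
  refine h1.congr' ?_
  filter_upwards [eventually_le_atBot n] with K hK
  rw [D.sum_block_Ico hK]

/-! ### The commutator as a double sum over dyadic blocks -/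

theorem blockComm_block_of_le {j k : ℤ} (h : j + 3 ≤ k ∨ k + 3 ≤ j) (l : ℤ) (b a : Distr) :
    D.blockComm j l b (D.block k a) = D.block j (D.blockMul l k b a) := by
  rw [blockComm, D.block_block_eq_zero (by omega), map_zero, sub_zero, blockMul]

/-- The contributions of the blocks to the commutator `[Δ_j, b] a`. The blocks of `a` close to the
frequency `2^j` give a true commutator; the other ones only matter for products whose spectrum
meets the one of `Δ_j`, which forces the frequency of `b` to be the highest one. -/
theorem exists_lpNorm_two_blockComm_block_le : ∃ C : ℝ≥0, ∀ (j l k : ℤ) (b a : Distr),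
    lpNorm 2 (D.block k a) ≠ ⊤ → lpNorm ⊤ (D.block l b) ≠ ⊤ →
    lpNorm 2 (D.blockComm j l b (D.block k a)) ≤
      (if k ∈ Finset.Icc (j - 2) (j + 2) then
        C * min 1 (ENNReal.ofReal (2 ^ (l - j))) *
          (lpNorm ⊤ (D.block l b) * lpNorm 2 (D.block k a)) else 0) +
      (if j ≤ l + 2 then 1 else 0) * (if k ≤ l + 2 then 1 else 0) *
        (lpNorm 2 (D.block l b) * lpNorm ⊤ (D.block k a)) := by
  obtain ⟨C, hC⟩ := D.exists_lpNorm_two_blockComm_le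
  refine ⟨2 + C, fun j l k b a ha hb => ?_⟩
  by_cases hjk : k ∈ Finset.Icc (j - 2) (j + 2)
  · rw [if_pos hjk]
    refine le_add_right ?_
    have h1 := hC j l b (D.block k a) ha hb
    have h2 := D.lpNorm_two_blockComm_le_two_mul j l b (D.block k a)
    rcases min_cases 1 (ENNReal.ofReal (2 ^ (l - j))) with h | h <;> rw [h.1]
    · refine h2.trans ?_
      gcongr
      simp
    · refine h1.trans ?_
      gcongr
      simp
  · rw [if_neg hjk, zero_add]
    have hjk' : j + 3 ≤ k ∨ k + 3 ≤ j := by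
      rw [Finset.mem_Icc] at hjk
      omega
    rw [D.blockComm_block_of_le hjk']
    by_cases h : j ≤ l + 2 ∧ k ≤ l + 2
    · rw [if_pos h.1, if_pos h.2, one_mul, one_mul]
      exact (D.lpNorm_two_block_le _ _).trans (D.lpNorm_blockMul_le' l k b a)
    · rw [D.block_blockMul_eq_zero (by omega), lpNorm_zero]
      exact zero_le

theorem lpNorm_two_le_tsum {ι κ : Type*} {F : ι → Distr} {t : κ → Finset ι} {l : Filter κ} [l.NeBot]
    {f : Distr} (h : Tendsto (fun i => ∑ x ∈ t i, F x) l (𝓝 f)) :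
    lpNorm 2 f ≤ ∑' x, lpNorm 2 (F x) :=
  lpNorm_two_le_of_tendsto h (Eventually.of_forall fun i =>
    (lpNorm_sum_le (t i) F).trans (ENNReal.sum_le_tsum (t i)))

theorem tendsto_block {ι : Type*} {l : Filter ι} {F : ι → Distr} {f : Distr} (j : ℤ)
    (h : Tendsto F l (𝓝 f)) : Tendsto (fun i => D.block j (F i)) l (𝓝 (D.block j f)) :=
  ((map_continuous (fourierMultiplierCLM ℂ (D.blockSymbol j))).tendsto f).comp h

theorem tendsto_smulLeftCLM {ι : Type*} {l : Filter ι} {F : ι → Distr} {f : Distr} (g : R3 → ℂ)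
    (h : Tendsto F l (𝓝 f)) :
    Tendsto (fun i => smulLeftCLM ℂ g (F i)) l (𝓝 (smulLeftCLM ℂ g f)) :=
  ((map_continuous (smulLeftCLM ℂ g)).tendsto f).comp h

theorem block_sum {ι : Type*} (j : ℤ) (t : Finset ι) (F : ι → Distr) :
    D.block j (∑ x ∈ t, F x) = ∑ x ∈ t, D.block j (F x) :=
  map_sum (fourierMultiplierCLM ℂ (D.blockSymbol j)) F t

/-- The product `b Δ_j a` exists, and it is the product with the smooth function `Δ_j a`. -/
theorem hasProduct_block (j : ℤ) (b a : Distr) :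
    D.HasProduct b (D.block j a) (smulLeftCLM ℂ (smoothRep (D.blockSymbol j) a) b) := by
  refine ⟨fun n => smoothRep (D.lowSymbol n) b, fun n => D.represents_lowFreq n b, ?_⟩
  refine (tendsto_smulLeftCLM (smoothRep (D.blockSymbol j) a) (D.tendsto_lowFreq b)).congr' ?_
  filter_upwards [eventually_ge_atTop (j + 2).toNat] with n hn
  rw [D.lowFreq_block_eq_self (by omega),
    smulLeftCLM_comm_of_represents (D.represents_block j a) (D.represents_lowFreq n b)]

/-- The commutator of `Δ_j` with the multiplication by `S_n b`, applied to one block of `a`. -/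
theorem lpNorm_two_commutator_lowFreq_le {b : Distr} (hb : D.MemSh b) (j k n : ℤ) (a : Distr) :
    lpNorm 2 (D.block j (smulLeftCLM ℂ (smoothRep (D.lowSymbol n) b) (D.block k a)) -
      smulLeftCLM ℂ (smoothRep (D.lowSymbol n) b) (D.block j (D.block k a))) ≤
      ∑' l : ℤ, lpNorm 2 (D.blockComm j l b (D.block k a)) := by
  rw [smulLeftCLM_comm_of_represents (D.represents_lowFreq n b) (D.represents_block k a),
    smulLeftCLM_comm_of_represents (D.represents_lowFreq n b) (D.represents_block j (D.block k a))]
  refine lpNorm_two_le_tsum (l := atBot) (t := fun K => Finset.Ico K n) ?_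
  have h := hb.tendsto_sum_block D n
  have h1 := (D.tendsto_block j (tendsto_smulLeftCLM (smoothRep (D.blockSymbol k) a) h)).sub
    (tendsto_smulLeftCLM (smoothRep (D.blockSymbol j) (D.block k a)) h)
  refine h1.congr fun K => ?_
  rw [map_sum, map_sum, block_sum, ← Finset.sum_sub_distrib]
  refine Finset.sum_congr rfl fun l _ => ?_
  rw [blockComm, smulLeftCLM_comm_of_represents (D.represents_block l b) (D.represents_block k a),
    smulLeftCLM_comm_of_represents (D.represents_block l b) (D.represents_block j (D.block k a))]

/-- The limits are taken in the order `n → ∞`, then the low frequencies of `a`, then those of `b`;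
`MemSh` removes the low-frequency remainders. -/
theorem lpNorm_two_commutator_tsum_le {a b P : Distr} (ha : D.MemSh a) (hb : D.MemSh b)
    (hP : Tendsto (fun n : ℕ => smulLeftCLM ℂ (smoothRep (D.lowSymbol n) b) (D.lowFreq n a)) atTop
      (𝓝 P)) (j : ℤ) :
    lpNorm 2 (D.block j P - smulLeftCLM ℂ (smoothRep (D.blockSymbol j) a) b) ≤
      ∑' k : ℤ, ∑' l : ℤ, lpNorm 2 (D.blockComm j l b (D.block k a)) := by
  have hQ : Tendsto (fun n : ℕ => smulLeftCLM ℂ (smoothRep (D.lowSymbol n) b)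
      (D.lowFreq n (D.block j a))) atTop
      (𝓝 (smulLeftCLM ℂ (smoothRep (D.blockSymbol j) a) b)) := by
    obtain ⟨g, hg, h⟩ := D.hasProduct_block j b a
    have : g = fun n : ℕ => smoothRep (D.lowSymbol n) b :=
      funext fun n => (hg n).unique (D.represents_lowFreq n b)
    rwa [this] at h
  refine lpNorm_two_le_of_tendsto ((D.tendsto_block j hP).sub hQ) (Eventually.of_forall fun n => ?_)
  set g := smoothRep (D.lowSymbol n) b
  have h := ha.tendsto_sum_block D n
  have h1 := (D.tendsto_block j (tendsto_smulLeftCLM g h)).sub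
    (tendsto_smulLeftCLM g (D.tendsto_block j h))
  rw [D.block_lowFreq_comm] at h1
  have h2 : Tendsto (fun K : ℤ => ∑ k ∈ Finset.Ico K (n : ℤ),
      (D.block j (smulLeftCLM ℂ g (D.block k a)) - smulLeftCLM ℂ g (D.block j (D.block k a)))) atBot
      (𝓝 (D.block j (smulLeftCLM ℂ g (D.lowFreq n a)) -
        smulLeftCLM ℂ g (D.lowFreq n (D.block j a)))) := by
    refine h1.congr fun K => ?_
    rw [map_sum, block_sum, block_sum, map_sum, ← Finset.sum_sub_distrib]
  exact (lpNorm_two_le_tsum h2).trans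
    (ENNReal.tsum_le_tsum fun k => D.lpNorm_two_commutator_lowFreq_le hb j k n a)

/-! ### Summation over the frequencies -/

/-- The pieces `[Δ_j, Δ_l b] Δ_k a` with `|k - j| ≤ 2`. -/
theorem exists_tsum_blockComm_near_le {s α : ℝ} (h0 : 0 < α) (h1 : α < 1) (C : ℝ≥0) :
    ∃ C' : ℝ≥0, ∀ a b : Distr,
    ∑' j : ℤ, (2 : ℝ≥0∞) ^ ((j : ℝ) * s) * ∑' k : ℤ, ∑' l : ℤ,
      (if k ∈ Finset.Icc (j - 2) (j + 2) then C * min 1 (ENNReal.ofReal (2 ^ (l - j))) *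
        (lpNorm ⊤ (D.block l b) * lpNorm 2 (D.block k a)) else 0) ≤
      C' * (D.besovNorm (s - α) 2 1 a * D.besovNorm α ⊤ ⊤ b) := by
  obtain ⟨C₁, hC₁⟩ := exists_tsum_min_two_rpow h0 h1
  set M : ℝ≥0∞ := 2 ^ (2 * |s - α|) with hM
  refine ⟨5 * M.toNNReal * C * C₁, fun a b => ?_⟩
  set N := D.besovNorm α ⊤ ⊤ b
  -- the sum over the frequencies of `b`
  have e1 : ∀ j k : ℤ, k ∈ Finset.Icc (j - 2) (j + 2) → (2 : ℝ≥0∞) ^ ((j : ℝ) * s) *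
      ∑' l : ℤ, C * min 1 (ENNReal.ofReal (2 ^ (l - j))) *
        (lpNorm ⊤ (D.block l b) * lpNorm 2 (D.block k a)) ≤
      M * C * C₁ * N * (2 ^ ((k : ℝ) * (s - α)) * lpNorm 2 (D.block k a)) := by
    intro j k hk
    have h2 : ∑' l : ℤ, C * min 1 (ENNReal.ofReal (2 ^ (l - j))) *
        (lpNorm ⊤ (D.block l b) * lpNorm 2 (D.block k a)) ≤
        C * N * lpNorm 2 (D.block k a) * (C₁ * 2 ^ (-((j : ℝ) * α))) := by
      refine le_trans ?_ (mul_le_mul_right (hC₁ j) _)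
      rw [← ENNReal.tsum_mul_left]
      refine ENNReal.tsum_le_tsum fun l => ?_
      calc _ ≤ C * min 1 (ENNReal.ofReal (2 ^ (l - j))) *
            ((2 ^ (-((l : ℝ) * α)) * N) * lpNorm 2 (D.block k a)) := by
            gcongr
            exact D.lpNorm_block_le_besovNorm_top α ⊤ b l
        _ = _ := by ring
    have h3 : (2 : ℝ≥0∞) ^ ((j : ℝ) * s) * 2 ^ (-((j : ℝ) * α)) ≤ M * 2 ^ ((k : ℝ) * (s - α)) := by
      rw [hM, ← two_rpow_add, ← two_rpow_add]
      apply two_rpow_le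
      have h4 : |((j : ℝ) - k)| ≤ 2 := by
        rw [Finset.mem_Icc] at hk
        have h5 : (j : ℝ) - 2 ≤ k := by exact_mod_cast hk.1
        have h6 : (k : ℝ) ≤ j + 2 := by exact_mod_cast hk.2
        rw [abs_le]
        constructor <;> linarith
      have h5 : ((j : ℝ) - k) * (s - α) ≤ 2 * |s - α| :=
        (le_abs_self _).trans (by rw [abs_mul]; gcongr)
      linarith
    calc _ ≤ (2 : ℝ≥0∞) ^ ((j : ℝ) * s) *
          (C * N * lpNorm 2 (D.block k a) * (C₁ * 2 ^ (-((j : ℝ) * α)))) := by gcongr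
      _ = (2 ^ ((j : ℝ) * s) * 2 ^ (-((j : ℝ) * α))) * (C * N * lpNorm 2 (D.block k a) * C₁) := by
          ring
      _ ≤ (M * 2 ^ ((k : ℝ) * (s - α))) * (C * N * lpNorm 2 (D.block k a) * C₁) := by gcongr
      _ = _ := by ring
  have e2 : ∀ k : ℤ, ∑' j : ℤ, (if k ∈ Finset.Icc (j - 2) (j + 2) then (1 : ℝ≥0∞) else 0) = 5 := by
    intro k
    rw [tsum_eq_sum (s := Finset.Icc (k - 2) (k + 2))]
    · rw [Finset.sum_congr rfl (g := fun _ => 1)]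
      · simp only [Finset.sum_const, Int.card_Icc, nsmul_eq_mul, mul_one]
        have : (k + 2 + 1 - (k - 2)).toNat = 5 := by omega
        rw [this]
        norm_num
      · intro j hj
        rw [Finset.mem_Icc] at hj
        rw [if_pos (by rw [Finset.mem_Icc]; omega)]
    · intro j hj
      rw [Finset.mem_Icc] at hj
      rw [if_neg (by rw [Finset.mem_Icc]; omega)]
  calc _ ≤ ∑' j : ℤ, ∑' k : ℤ, (if k ∈ Finset.Icc (j - 2) (j + 2) then (1 : ℝ≥0∞) else 0) *
        (M * C * C₁ * N * (2 ^ ((k : ℝ) * (s - α)) * lpNorm 2 (D.block k a))) := by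
        refine ENNReal.tsum_le_tsum fun j => ?_
        rw [← ENNReal.tsum_mul_left]
        refine ENNReal.tsum_le_tsum fun k => ?_
        by_cases hk : k ∈ Finset.Icc (j - 2) (j + 2)
        · simp only [if_pos hk, one_mul]
          exact e1 j k hk
        · simp only [if_neg hk, tsum_zero, mul_zero, zero_mul, le_refl]
    _ = ∑' k : ℤ, 5 * (M * C * C₁ * N * (2 ^ ((k : ℝ) * (s - α)) * lpNorm 2 (D.block k a))) := by
        rw [ENNReal.tsum_comm]
        refine tsum_congr fun k => ?_
        rw [ENNReal.tsum_mul_right, e2]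
    _ = _ := by
        rw [ENNReal.tsum_mul_left, ENNReal.tsum_mul_left, ← besovNorm_one]
        push_cast
        rw [ENNReal.coe_toNNReal (two_rpow_ne_top _)]
        ring

/-- The pieces for which the frequency `2^l` of `b` is the highest one. The sums over `j` and `k`
are geometric, dominated by `j = k = l + 2`. -/
theorem exists_tsum_blockComm_far_le {s α : ℝ} (hs : 0 < s) (h1 : α < 1) :
    ∃ C' : ℝ≥0, ∀ a b : Distr,
    ∑' j : ℤ, (2 : ℝ≥0∞) ^ ((j : ℝ) * s) * ∑' k : ℤ, ∑' l : ℤ,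
      (if j ≤ l + 2 then 1 else 0) * (if k ≤ l + 2 then 1 else 0) *
        (lpNorm 2 (D.block l b) * lpNorm ⊤ (D.block k a)) ≤
      C' * (D.besovNorm (s + 1 - α) 2 1 b * D.besovNorm (α - 1) ⊤ ⊤ a) := by
  obtain ⟨C₁, hC₁⟩ := exists_tsum_le_two_rpow hs
  obtain ⟨C₂, hC₂⟩ := exists_tsum_le_two_rpow (sub_pos.2 h1)
  set M : ℝ≥0∞ := 2 ^ (2 * (s + 1 - α)) with hM
  refine ⟨M.toNNReal * C₁ * C₂, fun a b => ?_⟩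
  set N := D.besovNorm (α - 1) ⊤ ⊤ a
  calc _ ≤ ∑' j : ℤ, ∑' k : ℤ, ∑' l : ℤ, (if j ≤ l + 2 then (2 : ℝ≥0∞) ^ ((j : ℝ) * s) else 0) *
        ((if k ≤ l + 2 then 2 ^ ((k : ℝ) * (1 - α)) else 0) * (N * lpNorm 2 (D.block l b))) := by
        simp_rw [← ENNReal.tsum_mul_left]
        refine ENNReal.tsum_le_tsum fun j => ENNReal.tsum_le_tsum fun k =>
          ENNReal.tsum_le_tsum fun l => ?_
        have h2 : lpNorm ⊤ (D.block k a) ≤ 2 ^ ((k : ℝ) * (1 - α)) * N := by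
          have := D.lpNorm_block_le_besovNorm_top (α - 1) ⊤ a k
          rwa [← mul_neg, neg_sub] at this
        by_cases hj : j ≤ l + 2
        · by_cases hk : k ≤ l + 2
          · simp only [if_pos hj, if_pos hk, one_mul]
            calc _ ≤ (2 : ℝ≥0∞) ^ ((j : ℝ) * s) *
                  (lpNorm 2 (D.block l b) * (2 ^ ((k : ℝ) * (1 - α)) * N)) := by gcongr
              _ = _ := by ring
          · simp [hk]
        · simp [hj]
    _ = ∑' l : ℤ, (∑' j : ℤ, (if j ≤ l + 2 then (2 : ℝ≥0∞) ^ ((j : ℝ) * s) else 0)) *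
        ((∑' k : ℤ, (if k ≤ l + 2 then (2 : ℝ≥0∞) ^ ((k : ℝ) * (1 - α)) else 0)) *
          (N * lpNorm 2 (D.block l b))) := by
        simp_rw [fun j : ℤ => ENNReal.tsum_comm (f := fun k l : ℤ =>
          (if j ≤ l + 2 then (2 : ℝ≥0∞) ^ ((j : ℝ) * s) else 0) *
          ((if k ≤ l + 2 then 2 ^ ((k : ℝ) * (1 - α)) else 0) * (N * lpNorm 2 (D.block l b))))]
        rw [ENNReal.tsum_comm]
        simp_rw [ENNReal.tsum_mul_left, ENNReal.tsum_mul_right]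
    _ ≤ ∑' l : ℤ, M * C₁ * C₂ * N * (2 ^ ((l : ℝ) * (s + 1 - α)) * lpNorm 2 (D.block l b)) := by
        refine ENNReal.tsum_le_tsum fun l => ?_
        calc _ ≤ (C₁ * 2 ^ (((l + 2 : ℤ) : ℝ) * s)) * ((C₂ * 2 ^ (((l + 2 : ℤ) : ℝ) * (1 - α))) *
              (N * lpNorm 2 (D.block l b))) := by
              gcongr
              · exact hC₁ (l + 2)
              · exact hC₂ (l + 2)
          _ = (2 ^ (((l + 2 : ℤ) : ℝ) * s) * 2 ^ (((l + 2 : ℤ) : ℝ) * (1 - α))) *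
              (C₁ * C₂ * N * lpNorm 2 (D.block l b)) := by ring
          _ = (M * 2 ^ ((l : ℝ) * (s + 1 - α))) * (C₁ * C₂ * N * lpNorm 2 (D.block l b)) := by
              congr 1
              rw [hM, ← two_rpow_add, ← two_rpow_add]
              congr 1
              push_cast
              ring
          _ = _ := by ring
    _ = _ := by
        rw [ENNReal.tsum_mul_left, ← besovNorm_one]
        push_cast
        rw [ENNReal.coe_toNNReal (two_rpow_ne_top _)]
        ring

/-- The commutator estimate, in terms of the dyadic blocks. -/
theorem exists_tsum_blockComm_le {s α : ℝ} (hs : 0 < s) (h0 : 0 < α) (h1 : α < 1) :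
    ∃ C : ℝ≥0, ∀ a b : Distr, D.besovNorm (s - α) 2 1 a ≠ ⊤ → D.besovNorm α ⊤ ⊤ b ≠ ⊤ →
    ∑' j : ℤ, (2 : ℝ≥0∞) ^ ((j : ℝ) * s) *
      ∑' k : ℤ, ∑' l : ℤ, lpNorm 2 (D.blockComm j l b (D.block k a)) ≤
      C * (D.besovNorm (s - α) 2 1 a * D.besovNorm α ⊤ ⊤ b +
        D.besovNorm (s + 1 - α) 2 1 b * D.besovNorm (α - 1) ⊤ ⊤ a) := by
  obtain ⟨C₀, hC₀⟩ := D.exists_lpNorm_two_blockComm_block_le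
  obtain ⟨C₁, hC₁⟩ := D.exists_tsum_blockComm_near_le (s := s) h0 h1 C₀
  obtain ⟨C₂, hC₂⟩ := D.exists_tsum_blockComm_far_le hs h1
  refine ⟨C₁ + C₂, fun a b ha hb => ?_⟩
  have h := fun j : ℤ => ENNReal.tsum_le_tsum fun k : ℤ => ENNReal.tsum_le_tsum fun l : ℤ =>
    hC₀ j l k b a (D.lpNorm_block_ne_top_of_besovNorm_one ha k)
      (D.lpNorm_block_ne_top_of_besovNorm_top hb l)
  simp_rw [ENNReal.tsum_add] at h
  refine (ENNReal.tsum_le_tsum fun j => mul_le_mul_right (h j) _).trans ?_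
  simp_rw [mul_add]
  rw [ENNReal.tsum_add]
  refine (add_le_add (hC₁ a b) (hC₂ a b)).trans ?_
  rw [ENNReal.coe_add]
  gcongr <;> simp

end DyadicPair

/-! ### Existence of the product -/

theorem exists_tendsto_of_tsum_lpNorm {ι : Type*} {p : ℝ≥0∞} [Fact (1 ≤ p)] (F : ι → Distr)
    (h : ∑' i, lpNorm p (F i) ≠ ⊤) :
    ∃ P : Distr, Tendsto (fun t : Finset ι => ∑ i ∈ t, F i) atTop (𝓝 P) := by
  have h1 : ∀ i, ∃ G : Lp ℂ p (volume : Measure R3), Lp.toTemperedDistribution G = F i := fun i =>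
    exists_of_lpNorm_ne_top (ENNReal.ne_top_of_tsum_ne_top h i)
  choose G hG using h1
  have h2 : Summable G := by
    apply Summable.of_nnnorm
    rw [← ENNReal.tsum_coe_ne_top_iff_summable]
    simp_rw [← hG, lpNorm_toTemperedDistribution] at h
    exact h
  have h3 := ((map_continuous (Lp.toTemperedDistributionCLM ℂ (volume : Measure R3) p)).tendsto
    _).comp h2.hasSum
  refine ⟨_, h3.congr fun t => ?_⟩
  rw [Function.comp_apply, map_sum]
  exact Finset.sum_congr rfl fun i _ => hG i

theorem enorm_besselSymbol_le_one (ξ : R3) :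
    ‖(((1 + ‖ξ‖ ^ 2) ^ ((-2 : ℝ) / 2) : ℝ) : ℂ)‖ₑ ≤ 1 := by
  rw [← ofReal_norm, Complex.norm_real, Real.norm_of_nonneg (by positivity)]
  rw [← ENNReal.ofReal_one]
  apply ENNReal.ofReal_le_ofReal
  exact Real.rpow_le_one_of_one_le_of_nonpos (by nlinarith [norm_nonneg ξ]) (by norm_num)

theorem lpNorm_two_besselPotential_le (f : Distr) :
    lpNorm 2 (besselPotential R3 ℂ (-2) f) ≤ lpNorm 2 f := by
  rw [besselPotential]
  simpa using lpNorm_two_fourierMultiplierCLM_le (by fun_prop) enorm_besselSymbol_le_one f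

namespace DyadicPair

variable (D : DyadicPair)

/-- On high frequencies the Bessel potential of order `-2` gains two powers of the frequency. -/
theorem lpNorm_two_besselPotential_le_of_lowFreq_eq_zero {m : ℤ} {f : Distr}
    (h : D.lowFreq m f = 0) :
    lpNorm 2 (besselPotential R3 ℂ (-2) f) ≤ 2 * 2 ^ (-((m : ℝ) * 2)) * lpNorm 2 f := by
  set u : R3 → ℂ := fun ξ => (((1 + ‖ξ‖ ^ 2) ^ ((-2 : ℝ) / 2) : ℝ) : ℂ) with hu
  have hut : u.HasTemperateGrowth := by fun_prop
  have h1t : (fun _ : R3 => (1 : ℂ)).HasTemperateGrowth := by fun_prop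
  set v : R3 → ℂ := (fun _ => 1) - ⇑(D.lowSymbol m) with hv
  have hvt : v.HasTemperateGrowth := h1t.sub (D.lowSymbol m).hasTemperateGrowth
  have e1 : fourierMultiplierCLM ℂ v f = f := by
    rw [hv, fourierMultiplierCLM_sub h1t (D.lowSymbol m).hasTemperateGrowth, sub_apply,
      ← D.lowFreq_eq, h]
    simp
  have e2 : besselPotential R3 ℂ (-2) f = fourierMultiplierCLM ℂ (v * u) f := by
    rw [← fourierMultiplierCLM_fourierMultiplierCLM_apply hvt hut, e1]
    rfl
  rw [e2]
  refine lpNorm_two_fourierMultiplierCLM_le (hvt.mul hut) (fun ξ => ?_) f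
  have e3 : (2 : ℝ≥0∞) * 2 ^ (-((m : ℝ) * 2)) = ENNReal.ofReal (2 * ((2 : ℝ) ^ m * 2 ^ m)⁻¹) := by
    rw [ENNReal.ofReal_mul (by norm_num), ← Real.rpow_intCast, ← Real.rpow_add (by norm_num),
      ← Real.rpow_neg (by norm_num), ← ENNReal.ofReal_rpow_of_pos (by norm_num),
      ENNReal.ofReal_ofNat]
    congr 2
    ring
  rw [e3, ← ofReal_norm, Pi.mul_apply, norm_mul]
  apply ENNReal.ofReal_le_ofReal
  have h2 : (0 : ℝ) < 2 ^ m := by positivity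
  rcases lt_or_ge ‖ξ‖ (3 / 4 * 2 ^ m) with hξ | hξ
  · have : v ξ = 0 := by simp [hv, D.lowSymbol_eq_one hξ]
    rw [this, norm_zero, zero_mul]
    positivity
  · have h3 : ‖v ξ‖ ≤ 1 := by
      rw [hv, Pi.sub_apply, D.lowSymbol_apply, ← Complex.ofReal_one, ← Complex.ofReal_sub,
        Complex.norm_real, Real.norm_of_nonneg (sub_nonneg.2 (D.χ_mem _).2)]
      linarith [(D.χ_mem ((2 : ℝ) ^ (-m) • ξ)).1]
    have h4 : ‖u ξ‖ = (1 + ‖ξ‖ ^ 2)⁻¹ := by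
      rw [hu, Complex.norm_real, Real.norm_of_nonneg (by positivity)]
      norm_num [Real.rpow_neg_one]
    calc ‖v ξ‖ * ‖u ξ‖ ≤ 1 * (1 + ‖ξ‖ ^ 2)⁻¹ := by
          rw [h4]
          gcongr
      _ ≤ 2 * ((2 : ℝ) ^ m * 2 ^ m)⁻¹ := by
          rw [one_mul, ← div_eq_mul_inv, inv_le_comm₀ (by positivity) (by positivity), inv_div]
          nlinarith

/-- The blocks `Δ_l b Δ_k a` are summable in the Sobolev space `H^{-2}`. -/
theorem tsum_besselPotential_blockMul_ne_top {s α : ℝ} (hs : 0 < s) (h0 : 0 < α) (h1 : α < 1)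
    {a b : Distr} (ha : D.besovNorm (s - α) 2 1 a ≠ ⊤) (ha' : D.besovNorm (α - 1) ⊤ ⊤ a ≠ ⊤)
    (hb : D.besovNorm (s + 1 - α) 2 1 b ≠ ⊤) (hb' : D.besovNorm α ⊤ ⊤ b ≠ ⊤) :
    ∑' x : ℕ × ℕ, lpNorm 2 (besselPotential R3 ℂ (-2) (D.blockMul x.1 x.2 b a)) ≠ ⊤ := by
  obtain ⟨C₁, hC₁⟩ := exists_tsum_ge_two_rpow h0
  obtain ⟨C₂, hC₂⟩ := exists_tsum_le_two_rpow (sub_pos.2 h1)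
  set Nb := D.besovNorm α ⊤ ⊤ b
  set Na := D.besovNorm (α - 1) ⊤ ⊤ a
  have hN : Function.Injective fun i : ℕ => (i : ℤ) := Nat.cast_injective
  have key : ∀ l k : ℕ, lpNorm 2 (besselPotential R3 ℂ (-2) (D.blockMul l k b a)) ≤
      (if (0 : ℤ) ≤ l then (2 : ℝ≥0∞) ^ (-(((l : ℤ) : ℝ) * α)) else 0) *
        (128 * Nb * (2 ^ (((k : ℤ) : ℝ) * (s - α)) * lpNorm 2 (D.block k a))) +
      (if (k : ℤ) ≤ l + 2 then (2 : ℝ≥0∞) ^ (((k : ℤ) : ℝ) * (1 - α)) else 0) *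
        (Na * lpNorm 2 (D.block l b)) := by
    intro l k
    rcases le_or_gt ((l : ℤ) + 3) k with h | h
    · -- `Δ_l b Δ_k a` has no frequencies below `2^{k-4}`, and `-2 (k - 3) ≤ 6 + k (s - α)`.
      refine le_add_right ?_
      rw [if_pos (by positivity)]
      calc _ ≤ 2 * 2 ^ (-(((k - 3 : ℤ) : ℝ) * 2)) * lpNorm 2 (D.blockMul l k b a) :=
            D.lpNorm_two_besselPotential_le_of_lowFreq_eq_zero (D.lowFreq_blockMul_eq_zero h b a)
        _ ≤ (2 * (2 ^ (6 : ℝ) * 2 ^ (((k : ℤ) : ℝ) * (s - α)))) *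
            ((2 ^ (-(((l : ℤ) : ℝ) * α)) * Nb) * lpNorm 2 (D.block k a)) := by
            gcongr
            · rw [← two_rpow_add]
              apply two_rpow_le
              have : (0 : ℝ) ≤ ((k : ℤ) : ℝ) := by positivity
              push_cast
              push_cast at this
              nlinarith
            · refine (D.lpNorm_blockMul_le l k b a).trans ?_
              gcongr
              exact D.lpNorm_block_le_besovNorm_top α ⊤ b l
        _ = _ := by
            have : (2 : ℝ≥0∞) ^ (6 : ℝ) = 64 := by
              rw [show (6 : ℝ) = ((6 : ℕ) : ℝ) by norm_num, ENNReal.rpow_natCast]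
              norm_num
            rw [this]
            ring
    · refine le_add_left ?_
      rw [if_pos (by omega)]
      refine (lpNorm_two_besselPotential_le _).trans ((D.lpNorm_blockMul_le' l k b a).trans ?_)
      have h2 : lpNorm ⊤ (D.block k a) ≤ 2 ^ (((k : ℤ) : ℝ) * (1 - α)) * Na := by
        have := D.lpNorm_block_le_besovNorm_top (α - 1) ⊤ a k
        rwa [← mul_neg, neg_sub] at this
      calc _ ≤ lpNorm 2 (D.block l b) * (2 ^ (((k : ℤ) : ℝ) * (1 - α)) * Na) := by gcongr
        _ = _ := by ring
  have hA : ∑' k : ℕ, (2 ^ (((k : ℤ) : ℝ) * (s - α)) * lpNorm 2 (D.block k a)) ≤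
      D.besovNorm (s - α) 2 1 a := by
    rw [besovNorm_one]
    exact ENNReal.tsum_comp_le_tsum_of_injective hN
      fun k : ℤ => 2 ^ ((k : ℝ) * (s - α)) * lpNorm 2 (D.block k a)
  have hB : ∑' l : ℕ, (2 ^ (((l : ℤ) : ℝ) * (s + 1 - α)) * lpNorm 2 (D.block l b)) ≤
      D.besovNorm (s + 1 - α) 2 1 b := by
    rw [besovNorm_one]
    exact ENNReal.tsum_comp_le_tsum_of_injective hN
      fun k : ℤ => 2 ^ ((k : ℝ) * (s + 1 - α)) * lpNorm 2 (D.block k b)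
  have hL : ∑' l : ℕ, (if (0 : ℤ) ≤ l then (2 : ℝ≥0∞) ^ (-(((l : ℤ) : ℝ) * α)) else 0) ≤
      C₁ * 2 ^ (-(((0 : ℤ) : ℝ) * α)) :=
    (ENNReal.tsum_comp_le_tsum_of_injective hN
      fun l : ℤ => if 0 ≤ l then (2 : ℝ≥0∞) ^ (-((l : ℝ) * α)) else 0).trans (hC₁ 0)
  have hK : ∀ l : ℕ, ∑' k : ℕ,
      (if (k : ℤ) ≤ l + 2 then (2 : ℝ≥0∞) ^ (((k : ℤ) : ℝ) * (1 - α)) else 0) ≤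
      C₂ * 2 ^ ((((l : ℤ) + 2 : ℤ) : ℝ) * (1 - α)) := fun l =>
    (ENNReal.tsum_comp_le_tsum_of_injective hN
      fun k : ℤ => if k ≤ l + 2 then (2 : ℝ≥0∞) ^ ((k : ℝ) * (1 - α)) else 0).trans (hC₂ _)
  have hle : ∑' x : ℕ × ℕ, lpNorm 2 (besselPotential R3 ℂ (-2) (D.blockMul x.1 x.2 b a)) ≤
      C₁ * 2 ^ (-(((0 : ℤ) : ℝ) * α)) * (128 * Nb * D.besovNorm (s - α) 2 1 a) +
      C₂ * 2 ^ (2 * (1 - α)) * Na * D.besovNorm (s + 1 - α) 2 1 b := by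
    rw [ENNReal.tsum_prod (f := fun l k : ℕ =>
      lpNorm 2 (besselPotential R3 ℂ (-2) (D.blockMul l k b a)))]
    refine (ENNReal.tsum_le_tsum fun l => ENNReal.tsum_le_tsum fun k => key l k).trans ?_
    simp_rw [ENNReal.tsum_add, ENNReal.tsum_mul_left, ENNReal.tsum_mul_right]
    refine add_le_add (by gcongr) ?_
    calc _ ≤ ∑' l : ℕ, C₂ * 2 ^ (2 * (1 - α)) * Na *
          (2 ^ (((l : ℤ) : ℝ) * (s + 1 - α)) * lpNorm 2 (D.block l b)) := by
          refine ENNReal.tsum_le_tsum fun l => ?_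
          have h2 : (2 : ℝ≥0∞) ^ ((((l : ℤ) + 2 : ℤ) : ℝ) * (1 - α)) ≤
              2 ^ (2 * (1 - α)) * 2 ^ (((l : ℤ) : ℝ) * (s + 1 - α)) := by
            rw [← two_rpow_add]
            apply two_rpow_le
            have : (0 : ℝ) ≤ ((l : ℤ) : ℝ) * s := by positivity
            push_cast
            push_cast at this
            linarith
          calc _ ≤ C₂ * 2 ^ ((((l : ℤ) + 2 : ℤ) : ℝ) * (1 - α)) *
                (Na * lpNorm 2 (D.block l b)) := by
                gcongr
                exact hK l
            _ ≤ C₂ * (2 ^ (2 * (1 - α)) * 2 ^ (((l : ℤ) : ℝ) * (s + 1 - α))) *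
                (Na * lpNorm 2 (D.block l b)) := by gcongr
            _ = _ := by ring
      _ ≤ _ := by
          rw [ENNReal.tsum_mul_left]
          gcongr
  refine ne_top_of_le_ne_top (ENNReal.add_ne_top.2 ⟨?_, ?_⟩) hle
  · exact ENNReal.mul_ne_top (ENNReal.mul_ne_top ENNReal.coe_ne_top (two_rpow_ne_top _))
      (ENNReal.mul_ne_top (ENNReal.mul_ne_top (by simp) hb') ha)
  · exact ENNReal.mul_ne_top (ENNReal.mul_ne_top (ENNReal.mul_ne_top ENNReal.coe_ne_top
      (two_rpow_ne_top _)) ha') hb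

/-- The low frequencies of `a` and `b` are split off, since the sums over the blocks converge
absolutely only at high frequencies. -/
theorem smulLeftCLM_lowFreq_eq (n : ℕ) (b a : Distr) :
    smulLeftCLM ℂ (smoothRep (D.lowSymbol n) b) (D.lowFreq n a) =
      smulLeftCLM ℂ (smoothRep (D.lowSymbol 0) a) (D.lowFreq n b) +
      smulLeftCLM ℂ (smoothRep (D.lowSymbol 0) b) (D.lowFreq n a - D.lowFreq 0 a) +
      ∑ x ∈ Finset.range n ×ˢ Finset.range n, D.blockMul x.1 x.2 b a := by
  have h1 : ∀ k : ℤ, smulLeftCLM ℂ (smoothRep (D.lowSymbol n) b) (D.block k a) =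
      smulLeftCLM ℂ (smoothRep (D.lowSymbol 0) b) (D.block k a) +
        ∑ l ∈ Finset.range n, D.blockMul l k b a := by
    intro k
    rw [smulLeftCLM_comm_of_represents (D.represents_lowFreq n b) (D.represents_block k a),
      smulLeftCLM_comm_of_represents (D.represents_lowFreq 0 b) (D.represents_block k a)]
    simp_rw [blockMul_eq]
    rw [← map_sum, ← map_add, D.sum_block_range n b]
    congr 1
    abel
  rw [smulLeftCLM_comm_of_represents (D.represents_lowFreq 0 a) (D.represents_lowFreq n b),
    Finset.sum_product_right, ← D.sum_block_range n a, add_assoc, map_sum,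
    ← Finset.sum_add_distrib]
  simp_rw [← h1]
  rw [← map_sum, D.sum_block_range n a, ← map_add]
  congr 1
  abel

/-- The product of `b` and `a` exists. The sum over the high-frequency blocks converges in `H^{-2}`:
their Bessel potentials of order `-2` are summable in `L²`. -/
theorem exists_tendsto_mul {s α : ℝ} (hs : 0 < s) (h0 : 0 < α) (h1 : α < 1)
    {a b : Distr} (ha : D.besovNorm (s - α) 2 1 a ≠ ⊤) (ha' : D.besovNorm (α - 1) ⊤ ⊤ a ≠ ⊤)
    (hb : D.besovNorm (s + 1 - α) 2 1 b ≠ ⊤) (hb' : D.besovNorm α ⊤ ⊤ b ≠ ⊤) :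
    ∃ P : Distr, Tendsto (fun n : ℕ =>
      smulLeftCLM ℂ (smoothRep (D.lowSymbol n) b) (D.lowFreq n a)) atTop (𝓝 P) := by
  obtain ⟨P, hP⟩ := exists_tendsto_of_tsum_lpNorm _
    (D.tsum_besselPotential_blockMul_ne_top hs h0 h1 ha ha' hb hb')
  have h2 := ((map_continuous (besselPotential R3 ℂ 2)).tendsto P).comp hP
  have h3 : Tendsto (fun n : ℕ => Finset.range n ×ˢ Finset.range n) atTop atTop := by
    refine tendsto_atTop_finset_of_monotone (fun m n h => ?_) fun x => ⟨max x.1 x.2 + 1, ?_⟩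
    · have := Finset.range_mono h
      exact Finset.product_subset_product this this
    · rw [Finset.mem_product, Finset.mem_range, Finset.mem_range]
      omega
  have h4 := h2.comp h3
  have h5 := tendsto_smulLeftCLM (smoothRep (D.lowSymbol 0) a) (D.tendsto_lowFreq b)
  have h6 := tendsto_smulLeftCLM (smoothRep (D.lowSymbol 0) b)
    ((D.tendsto_lowFreq a).sub_const (D.lowFreq 0 a))
  refine ⟨_, ((h5.add h6).add h4).congr fun n => ?_⟩
  rw [D.smulLeftCLM_lowFreq_eq n b a]
  congr 1
  simp only [Function.comp_apply]
  rw [map_sum]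
  refine Finset.sum_congr rfl fun x _ => ?_
  rw [besselPotential_besselPotential_apply]
  simp

end DyadicPair

end LittlewoodPaley

end

theorem lemma4 (D : LittlewoodPaley.DyadicPair) (s ρ : ℝ) (hs : 0 < s) (hρ : 2 < ρ) :
    ∃ C : ℝ≥0, ∀ a b : LittlewoodPaley.Distr,
      D.MemBesov (s - 2 / ρ) 2 1 a → D.MemBesov (2 / ρ - 1) ⊤ ⊤ a →
      D.MemBesov (s + 1 - 2 / ρ) 2 1 b → D.MemBesov (2 / ρ) ⊤ ⊤ b →
      ∃ c : ℤ → LittlewoodPaley.Distr,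
        (∀ j : ℤ, D.IsCommutator j b a (c j)) ∧
        ∑' j : ℤ, (2 : ℝ≥0∞) ^ ((j : ℝ) * s) * LittlewoodPaley.lpNorm 2 (c j) ≤
          (C : ℝ≥0∞) *
            (D.besovNorm (s - 2 / ρ) 2 1 a * D.besovNorm (2 / ρ) ⊤ ⊤ b +
              D.besovNorm (s + 1 - 2 / ρ) 2 1 b * D.besovNorm (2 / ρ - 1) ⊤ ⊤ a) := by
  have hα0 : 0 < 2 / ρ := by positivity
  have hα1 : 2 / ρ < 1 := by rwa [div_lt_one (by linarith)]
  obtain ⟨C, hC⟩ := D.exists_tsum_blockComm_le hs hα0 hα1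
  refine ⟨C, fun a b ha ha' hb hb' => ?_⟩
  obtain ⟨P, hP⟩ := D.exists_tendsto_mul hs hα0 hα1 ha.2.ne ha'.2.ne hb.2.ne hb'.2.ne
  refine ⟨fun j => D.block j P - TemperedDistribution.smulLeftCLM ℂ
    (LittlewoodPaley.smoothRep (D.blockSymbol j) a) b, fun j => ?_, ?_⟩
  · exact ⟨P, _, ⟨fun n => LittlewoodPaley.smoothRep (D.lowSymbol n) b,
      fun n => D.represents_lowFreq n b, hP⟩, D.hasProduct_block j b a, rfl⟩
  · refine le_trans (ENNReal.tsum_le_tsum fun j => ?_) (hC a b ha.2.ne hb'.2.ne)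
    gcongr
    exact D.lpNorm_two_commutator_tsum_le ha.1 hb.1 hP j
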